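/- Let $\mathbb F$ be any field of characteristic $p>0$. Let $\mathbb F[t,\sigma]$ be the skew polynomial ring with $t\alpha=\alpha^p t$ for $\alpha\in\mathbb F$. Let $\mathcal L=\langle x\rangle_p$ be the free cyclic restricted Lie algebra over $\mathbb F$, i.e. the abelian one with basis $x,x^{[p]},x^{[p]^2},\dots$. For $f=\sum_k\alpha_k t^k\in\mathbb F[t,\sigma]$ put $\bar f=\sum_k\alpha_k x^{[p]^k}\in\mathcal L$. Here $\langle S\rangle_p$ denotes the restricted subalgebra generated by $S$. A restricted Lie algebra $L$ is called dually atomistic if every restricted subalgebra of $L$ is an intersection of maximal restricted subalgebras of $L$ ($L$ itself being the empty intersection). Proposition. Let $L$ be a finite-dimensional solvable restricted Lie algebra over $\mathbb F$. If $L$ is dually atomistic, then there are integers $0\le r\le n$, an abelian restricted ideal $A$ of $L$ and an element $b\in L$ with $b^{[p]}=b$ such that $L=A\dotplus\mathbb F b$ (direct sum of vector spaces) and $$A=A_1\oplus\cdots\oplus A_r\oplus\mathbb F x_{r+1}\oplus\cdots\oplus\mathbb F x_n$$ is a direct sum of restricted subalgebras, where, for $1\le i\le r$, $A_i\cong\mathcal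 L/\langle\bar f_i\rangle_p$ as restricted Lie algebras for some irreducible element $f_i$ of $\mathbb F[t,\sigma]$, and $x_j\neq0$ for $r<j\le n$. If $L$ is not abelian, then $r\ne n$ and $b\neq0$. If $L$ is abelian, one can take $r=n$ and $b=0$, so that $L\cong\mathcal L/\langle\bar f_1\rangle_p\oplus\cdots\oplus\mathcal L/\langle\bar f_n\rangle_p$. -/

import Mathlib

open Polynomial

/-! ### Restricted Lie algebras -/

/-- The coefficient of `X ^ k` in `ad (X x + y) ^ n (x)`, computed in `L[X]` with `X` central. -/
noncomputable def adCoeff (F : Type*) {L : Type*} [Field F] [LieRing L] [LieAlgebra F L]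
    (x y : L) (n k : ℕ) : L :=
  (((C (LieAlgebra.ad F L x) * X + C (LieAlgebra.ad F L y) : (Module.End F L)[X]) ^ n).coeff k) x

/-- The Lie polynomial `s_i(x, y)` of Jacobson's formula: `i s_i(x, y)` is the coefficient of
`X ^ (i - 1)` in `ad (X x + y) ^ (p - 1) (x)`. -/
noncomputable def jacobsonTerm (F : Type*) (p : ℕ) {L : Type*} [Field F] [LieRing L]
    [LieAlgebra F L] (x y : L) (i : ℕ) : L :=
  (i : F)⁻¹ • adCoeff F x y (p - 1) (i - 1)

/-- A restricted Lie algebra (in the sense of Jacobson) over a field `F` of characteristic `p`: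
a Lie algebra together with a `p`-map `x ↦ x^[p]`. -/
class RestrictedLieAlgebra (F : Type*) (p : ℕ) (L : Type*) [Field F] [LieRing L]
    [LieAlgebra F L] where
  /-- The `p`-map `x ↦ x^[p]`. -/
  pMap : L → L
  ad_pMap : ∀ x : L, LieAlgebra.ad F L (pMap x) = LieAlgebra.ad F L x ^ p
  pMap_smul : ∀ (a : F) (x : L), pMap (a • x) = a ^ p • pMap x
  pMap_add : ∀ x y : L,
    pMap (x + y) = pMap x + pMap y + ∑ i ∈ Finset.Icc 1 (p - 1), jacobsonTerm F p x y i

/-- The `p`-map `x ↦ x^[p]` of a restricted Lie algebra. -/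
def pMap (F : Type*) (p : ℕ) {L : Type*} [Field F] [LieRing L] [LieAlgebra F L]
    [RestrictedLieAlgebra F p L] (x : L) : L :=
  RestrictedLieAlgebra.pMap F p x

section JacobsonLemmas

variable {F : Type*} {p : ℕ} {L M : Type*} [Field F] [LieRing L] [LieAlgebra F L]
  [LieRing M] [LieAlgebra F M]

theorem adCoeff_zero_zero (x y : L) : adCoeff F x y 0 0 = x := by
  simp [adCoeff]

theorem adCoeff_zero_succ (x y : L) (k : ℕ) : adCoeff F x y 0 (k + 1) = 0 := by
  simp [adCoeff, coeff_one]

theorem adCoeff_succ_zero (x y : L) (n : ℕ) :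
    adCoeff F x y (n + 1) 0 = ⁅y, adCoeff F x y n 0⁆ := by
  simp [adCoeff, pow_succ', add_mul, mul_assoc, -map_mul]

theorem adCoeff_succ_succ (x y : L) (n k : ℕ) :
    adCoeff F x y (n + 1) (k + 1) = ⁅x, adCoeff F x y n k⁆ + ⁅y, adCoeff F x y n (k + 1)⁆ := by
  simp [adCoeff, pow_succ', add_mul, mul_assoc, -map_mul]

theorem map_adCoeff (f : L →ₗ⁅F⁆ M) (x y : L) (n k : ℕ) :
    f (adCoeff F x y n k) = adCoeff F (f x) (f y) n k := by
  induction n generalizing k with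
  | zero => cases k <;> simp [adCoeff_zero_zero, adCoeff_zero_succ]
  | succ n ih => cases k <;> simp [adCoeff_succ_zero, adCoeff_succ_succ, ih]

theorem map_jacobsonTerm (f : L →ₗ⁅F⁆ M) (x y : L) (i : ℕ) :
    f (jacobsonTerm F p x y i) = jacobsonTerm F p (f x) (f y) i := by
  simp [jacobsonTerm, map_adCoeff]

theorem adCoeff_eq_zero_of_lie_eq_zero {x y : L} (h : ⁅y, x⁆ = 0) (n k : ℕ) :
    adCoeff F x y (n + 1) k = 0 := by
  induction n generalizing k with
  | zero =>
    rcases k with _ | _ | k <;>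
      simp [adCoeff_zero_zero, adCoeff_zero_succ, adCoeff_succ_zero, adCoeff_succ_succ, h]
  | succ n ih => cases k <;> simp [adCoeff_succ_zero (n := n + 1), adCoeff_succ_succ (n := n + 1), ih]

/-- The terms of Jacobson's formula vanish on commuting elements. -/
theorem jacobsonTerm_eq_zero {x y : L} (h : ⁅y, x⁆ = 0) {i : ℕ}
    (hi : i ∈ Finset.Icc 1 (p - 1)) : jacobsonTerm F p x y i = 0 := by
  have h1 : p - 1 = (p - 2) + 1 := by
    have := Finset.mem_Icc.1 hi
    omega
  rw [jacobsonTerm, h1, adCoeff_eq_zero_of_lie_eq_zero h, smul_zero]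

theorem adCoeff_mem (I : LieIdeal F L) {x y : L} (hy : y ∈ I) {n k : ℕ} (hk : k < n) :
    adCoeff F x y n k ∈ I := by
  induction n generalizing k with
  | zero => omega
  | succ n ih =>
    cases k with
    | zero =>
      rw [adCoeff_succ_zero]
      exact lie_mem_left F L I _ _ hy
    | succ k =>
      rw [adCoeff_succ_succ]
      exact add_mem (lie_mem_right F L I _ _ (ih (by omega))) (lie_mem_left F L I _ _ hy)

theorem jacobsonTerm_mem (I : LieIdeal F L) {x y : L} (hy : y ∈ I) {i : ℕ}
    (hi : i ∈ Finset.Icc 1 (p - 1)) : jacobsonTerm F p x y i ∈ I := by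
  have := Finset.mem_Icc.1 hi
  exact I.smul_mem _ (adCoeff_mem I hy (by omega))

section

variable [RestrictedLieAlgebra F p L]

variable (F p) in
theorem lie_pMap (x z : L) : ⁅pMap F p x, z⁆ = (LieAlgebra.ad F L x ^ p) z := by
  rw [← RestrictedLieAlgebra.ad_pMap (F := F) (p := p) x]
  rfl

theorem pMap_smul (a : F) (x : L) : pMap F p (a • x) = a ^ p • pMap F p x :=
  RestrictedLieAlgebra.pMap_smul a x

variable (F p) in
theorem pMap_add (x y : L) : pMap F p (x + y) =
    pMap F p x + pMap F p y + ∑ i ∈ Finset.Icc 1 (p - 1), jacobsonTerm F p x y i :=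
  RestrictedLieAlgebra.pMap_add x y

end

end JacobsonLemmas

/-- An isomorphism of restricted Lie algebras. -/
structure RestrictedLieEquiv (F : Type*) (p : ℕ) (L M : Type*) [Field F] [LieRing L]
    [LieAlgebra F L] [RestrictedLieAlgebra F p L] [LieRing M] [LieAlgebra F M]
    [RestrictedLieAlgebra F p M] extends L ≃ₗ⁅F⁆ M where
  map_pMap : ∀ x : L, toLieEquiv (pMap F p x) = pMap F p (toLieEquiv x)

/-! ### Restricted subalgebras -/

/-- A restricted subalgebra: a Lie subalgebra closed under the `p`-map. -/
structure RestrictedSubalgebra (F : Type*) (p : ℕ) (L : Type*) [Field F] [LieRing L]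
    [LieAlgebra F L] [RestrictedLieAlgebra F p L] extends LieSubalgebra F L where
  pMap_mem' : ∀ {x : L}, x ∈ carrier → pMap F p x ∈ carrier

namespace RestrictedSubalgebra

variable {F : Type*} {p : ℕ} {L : Type*} [Field F] [LieRing L] [LieAlgebra F L]
  [RestrictedLieAlgebra F p L]

instance : SetLike (RestrictedSubalgebra F p L) L where
  coe S := S.carrier
  coe_injective := by
    rintro ⟨S, hS⟩ ⟨T, hT⟩ h
    congr
    exact SetLike.coe_injective h

instance : PartialOrder (RestrictedSubalgebra F p L) := .ofSetLike (RestrictedSubalgebra F p L) L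

instance : OrderTop (RestrictedSubalgebra F p L) where
  top := { (⊤ : LieSubalgebra F L) with pMap_mem' := fun _ => LieSubalgebra.mem_top _ }
  le_top _ _ _ := LieSubalgebra.mem_top _

/-- The restricted subalgebra `⟨s⟩_p` generated by a set `s`: the intersection of all restricted
subalgebras containing `s`. -/
def span (s : Set L) : RestrictedSubalgebra F p L where
  carrier := {x | ∀ S : RestrictedSubalgebra F p L, s ⊆ S → x ∈ S}
  add_mem' hx hy S hS := S.toLieSubalgebra.add_mem (hx S hS) (hy S hS)
  zero_mem' S _ := S.toLieSubalgebra.zero_mem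
  smul_mem' a _ hx S hS := S.toLieSubalgebra.smul_mem a (hx S hS)
  lie_mem' hx hy S hS := S.toLieSubalgebra.lie_mem (hx S hS) (hy S hS)
  pMap_mem' hx S hS := S.pMap_mem' (hx S hS)

/-- A restricted subalgebra is itself a Lie algebra, with the operations of `L`. -/
instance (S : RestrictedSubalgebra F p L) : LieRing S :=
  inferInstanceAs (LieRing S.toLieSubalgebra)

instance (S : RestrictedSubalgebra F p L) : LieAlgebra F S :=
  inferInstanceAs (LieAlgebra F S.toLieSubalgebra)

/-- The inclusion of a restricted subalgebra, as a Lie algebra homomorphism. -/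
def incl (S : RestrictedSubalgebra F p L) : S →ₗ⁅F⁆ L := S.toLieSubalgebra.incl

theorem incl_apply (S : RestrictedSubalgebra F p L) (x : S) : S.incl x = x := rfl

/-- A restricted subalgebra is itself a restricted Lie algebra, with the `p`-map of `L`. -/
instance (S : RestrictedSubalgebra F p L) : RestrictedLieAlgebra F p S where
  pMap x := ⟨pMap F p (x : L), S.pMap_mem' x.2⟩
  ad_pMap x := by
    ext z
    have h : ∀ n : ℕ, S.incl ((LieAlgebra.ad F S x ^ n) z)
        = (LieAlgebra.ad F L (x : L) ^ n) (z : L) := by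
      intro n
      induction n with
      | zero => rfl
      | succ n ih =>
        rw [pow_succ', pow_succ', Module.End.mul_apply, Module.End.mul_apply, ← ih]
        rfl
    exact (lie_pMap F p (x : L) (z : L)).trans (h p).symm
  pMap_smul a x := Subtype.ext (pMap_smul a (x : L))
  pMap_add x y := by
    apply Subtype.ext
    change pMap F p ((x : L) + y) = S.incl (_ + _ + _)
    rw [map_add, map_add, map_sum, pMap_add]
    simp only [map_jacobsonTerm]
    rfl

/-- A restricted subalgebra is an ideal. -/
def IsIdeal (S : RestrictedSubalgebra F p L) : Prop :=
  ∀ (x : L) {y : L}, y ∈ S → ⁅x, y⁆ ∈ S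

/-- A restricted subalgebra which is an ideal, as a Lie ideal. -/
def toLieIdeal (S : RestrictedSubalgebra F p L) (hS : S.IsIdeal) : LieIdeal F L where
  toSubmodule := S.toSubmodule
  lie_mem {x} _ hy := hS x hy

end RestrictedSubalgebra

/-- `L` is dually atomistic: every restricted subalgebra of `L` is an intersection of maximal
restricted subalgebras of `L` (`L` itself being the empty intersection). -/
def IsDuallyAtomistic (F : Type*) (p : ℕ) (L : Type*) [Field F] [LieRing L]
    [LieAlgebra F L] [RestrictedLieAlgebra F p L] : Prop :=
  ∀ S : RestrictedSubalgebra F p L, ∃ 𝓜 : Set (RestrictedSubalgebra F p L),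
    (∀ M ∈ 𝓜, IsCoatom M) ∧ (S : Set L) = ⋂ M ∈ 𝓜, (M : Set L)

/-- An element `b` is toral if `b^[p] = b`. -/
def IsToral (F : Type*) (p : ℕ) {L : Type*} [Field F] [LieRing L]
    [LieAlgebra F L] [RestrictedLieAlgebra F p L] (b : L) : Prop :=
  pMap F p b = b

/-! ### Quotients by restricted ideals -/

/-- The quotient `L / I` of a restricted Lie algebra by a restricted ideal, as a type. -/
abbrev RestrictedSubalgebra.Quotient {F : Type*} {p : ℕ} {L : Type*} [Field F] [LieRing L]
    [LieAlgebra F L] [RestrictedLieAlgebra F p L] (I : RestrictedSubalgebra F p L)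
    (hI : I.IsIdeal) : Type _ :=
  L ⧸ I.toLieIdeal hI

section Quotient

variable {F : Type*} {p : ℕ} {L : Type*} [Field F] [LieRing L] [LieAlgebra F L]
  [RestrictedLieAlgebra F p L]

/-- The projection onto a quotient, as a Lie algebra homomorphism. -/
def quotientMk (I : LieIdeal F L) : L →ₗ⁅F⁆ L ⧸ I :=
  { (LieSubmodule.Quotient.mk' I : L →ₗ[F] L ⧸ I) with
    map_lie' := fun {_ _} => rfl }

theorem quotientMk_surjective (I : LieIdeal F L) : Function.Surjective (quotientMk I) :=
  LieSubmodule.Quotient.surjective_mk' I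

theorem quotientMk_eq_iff (I : LieIdeal F L) (x y : L) :
    quotientMk I x = quotientMk I y ↔ x - y ∈ I :=
  Submodule.Quotient.eq I.toSubmodule

theorem quotientMk_pMap_congr (I : RestrictedSubalgebra F p L) (hI : I.IsIdeal) (x y : L)
    (h : x - y ∈ I.toLieIdeal hI) :
    quotientMk (I.toLieIdeal hI) (pMap F p x) = quotientMk (I.toLieIdeal hI) (pMap F p y) := by
  obtain ⟨z, rfl⟩ : ∃ z, x = y + z := ⟨x - y, by abel⟩
  rw [add_sub_cancel_left] at h
  rw [quotientMk_eq_iff, pMap_add]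
  have h1 : pMap F p z ∈ I.toLieIdeal hI := I.pMap_mem' h
  have h2 : ∑ i ∈ Finset.Icc 1 (p - 1), jacobsonTerm F p y z i ∈ I.toLieIdeal hI :=
    sum_mem fun i hi => jacobsonTerm_mem _ h hi
  have h3 := add_mem h1 h2
  convert h3 using 1
  abel

/-- The quotient by a restricted ideal is a restricted Lie algebra, with the `p`-map
`(x + I)^[p] = x^[p] + I`. -/
instance (I : RestrictedSubalgebra F p L) (hI : I.IsIdeal) :
    RestrictedLieAlgebra F p (I.Quotient hI) :=
  let P : I.Quotient hI → I.Quotient hI :=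
    Quotient.lift (fun x : L => quotientMk (I.toLieIdeal hI) (pMap F p x)) fun x y h =>
      quotientMk_pMap_congr I hI x y ((quotientMk_eq_iff _ x y).1 (Quotient.sound h))
  have hP : ∀ x : L, P (quotientMk (I.toLieIdeal hI) x)
      = quotientMk (I.toLieIdeal hI) (pMap F p x) := fun _ => rfl
  { pMap := P
    ad_pMap := fun x => by
      obtain ⟨x, rfl⟩ := quotientMk_surjective _ x
      apply LinearMap.ext
      intro z
      obtain ⟨z, rfl⟩ := quotientMk_surjective _ z
      have h : ∀ n : ℕ, (LieAlgebra.ad F (I.Quotient hI) (quotientMk (I.toLieIdeal hI) x) ^ n)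
          (quotientMk (I.toLieIdeal hI) z)
          = quotientMk (I.toLieIdeal hI) ((LieAlgebra.ad F L x ^ n) z) := by
        intro n
        induction n with
        | zero => rfl
        | succ n ih =>
          rw [pow_succ', pow_succ', Module.End.mul_apply, Module.End.mul_apply, ih]
          rfl
      rw [h, hP, LieAlgebra.ad_apply, ← LieHom.map_lie, lie_pMap]
    pMap_smul := fun a x => by
      obtain ⟨x, rfl⟩ := quotientMk_surjective _ x
      rw [← map_smul, hP, hP, pMap_smul, map_smul]
    pMap_add := fun x y => by
      obtain ⟨x, rfl⟩ := quotientMk_surjective _ x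
      obtain ⟨y, rfl⟩ := quotientMk_surjective _ y
      rw [← map_add, hP, hP, hP, pMap_add, map_add, map_add, map_sum]
      simp only [map_jacobsonTerm] }

end Quotient

/-! ### The free cyclic restricted Lie algebra -/

/-- The free cyclic restricted Lie algebra `𝓛 = ⟨x⟩_p`: the abelian Lie algebra with basis
`x, x^[p], x^[p]^2, …`. -/
def FreeCyclic (F : Type*) (p : ℕ) [Field F] : Type _ := ℕ →₀ F

namespace FreeCyclic

variable (F : Type*) (p : ℕ) [Field F]

noncomputable instance : AddCommGroup (FreeCyclic F p) := inferInstanceAs (AddCommGroup (ℕ →₀ F))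

noncomputable instance : Module F (FreeCyclic F p) := inferInstanceAs (Module F (ℕ →₀ F))

noncomputable instance : LieRing (FreeCyclic F p) where
  bracket _ _ := 0
  add_lie _ _ _ := (add_zero 0).symm
  lie_add _ _ _ := (add_zero 0).symm
  lie_self _ := rfl
  leibniz_lie _ _ _ := (add_zero 0).symm

noncomputable instance : LieAlgebra F (FreeCyclic F p) where
  lie_smul a _ _ := (smul_zero a).symm

variable {F p} in
theorem lie_eq_zero (x y : FreeCyclic F p) : ⁅x, y⁆ = 0 := rfl

/-- The basis vector `x^[p]^k`. -/
noncomputable def basisVec (k : ℕ) : FreeCyclic F p := Finsupp.single k (1 : F)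

/-- The free generator `x`. -/
noncomputable def gen : FreeCyclic F p := basisVec F p 0

variable [Fact p.Prime] [CharP F p]

/-- The `p`-map sends `∑ α_k x^[p]^k` to `∑ α_k ^ p x^[p]^(k+1)`. -/
noncomputable instance : RestrictedLieAlgebra F p (FreeCyclic F p) where
  pMap v := (show ℕ →₀ F from v).sum fun k a => a ^ p • basisVec F p (k + 1)
  ad_pMap x := by
    have hp : p ≠ 0 := (Fact.out : p.Prime).ne_zero
    have h : ∀ v : FreeCyclic F p, LieAlgebra.ad F (FreeCyclic F p) v = 0 := fun v => rfl
    rw [h, h, zero_pow hp]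
  pMap_smul a v := by
    have hp : p ≠ 0 := (Fact.out : p.Prime).ne_zero
    refine (Finsupp.sum_smul_index (b := a) (g := (show ℕ →₀ F from v))
      (h := fun k a => a ^ p • basisVec F p (k + 1)) ?_).trans ?_
    · intro i
      rw [zero_pow hp, zero_smul]
    · rw [Finsupp.smul_sum]
      simp only [mul_pow, mul_smul]
  pMap_add x y := by
    have hp : p ≠ 0 := (Fact.out : p.Prime).ne_zero
    rw [Finset.sum_eq_zero fun i hi => jacobsonTerm_eq_zero (lie_eq_zero y x) hi, add_zero]
    refine Finsupp.sum_add_index' (f := (show ℕ →₀ F from x)) (g := (show ℕ →₀ F from y))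
      (h := fun k a => a ^ p • basisVec F p (k + 1)) ?_ ?_
    · intro i
      rw [zero_pow hp, zero_smul]
    · intro i a b
      rw [add_pow_char, add_smul]

theorem pMap_basisVec (k : ℕ) : pMap F p (basisVec F p k) = basisVec F p (k + 1) := by
  have hp : p ≠ 0 := (Fact.out : p.Prime).ne_zero
  refine (Finsupp.sum_single_index (h := fun k a => a ^ p • basisVec F p (k + 1)) ?_).trans ?_
  · rw [zero_pow hp, zero_smul]
  · rw [one_pow, one_smul]

theorem isIdeal (S : RestrictedSubalgebra F p (FreeCyclic F p)) : S.IsIdeal :=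
  fun _ _ _ => S.toLieSubalgebra.zero_mem

/-- `𝓛` is free on `x`: for every element `m` of a restricted Lie algebra `M` there is a unique
homomorphism of restricted Lie algebras `𝓛 → M` sending `x` to `m`. -/
theorem existsUnique_hom {M : Type*} [LieRing M] [LieAlgebra F M] [RestrictedLieAlgebra F p M]
    (m : M) : ∃! f : FreeCyclic F p →ₗ⁅F⁆ M,
      (∀ v, f (pMap F p v) = pMap F p (f v)) ∧ f (gen F p) = m := by
  have hp : p ≠ 0 := (Fact.out : p.Prime).ne_zero
  have had : ∀ (k : ℕ) (z : M), ⁅(pMap F p)^[k] m, z⁆ = (LieAlgebra.ad F M m ^ p ^ k) z := by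
    intro k
    induction k with
    | zero => intro z; simp
    | succ k ih =>
      intro z
      have h1 : LieAlgebra.ad F M ((pMap F p)^[k] m) = LieAlgebra.ad F M m ^ p ^ k :=
        LinearMap.ext ih
      rw [Function.iterate_succ_apply', lie_pMap, h1, ← pow_mul, pow_succ]
  have hzero : ∀ (k : ℕ) (z : M), ⁅m, z⁆ = 0 → ⁅(pMap F p)^[k] m, z⁆ = 0 := by
    intro k z hz
    have hk : p ^ k = (p ^ k - 1) + 1 := by
      have : 0 < p ^ k := pow_pos (Nat.pos_of_ne_zero hp) k
      omega
    rw [had, hk, pow_succ, Module.End.mul_apply, LieAlgebra.ad_apply, hz, map_zero]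
  have hcomm : ∀ i j : ℕ, ⁅(pMap F p)^[i] m, (pMap F p)^[j] m⁆ = 0 := by
    intro i j
    apply hzero
    rw [← lie_skew, hzero j m (lie_self m), neg_zero]
  let g : FreeCyclic F p →ₗ[F] M :=
    Finsupp.linearCombination F (fun k : ℕ => (pMap F p)^[k] m)
  have hg : ∀ k, g (basisVec F p k) = (pMap F p)^[k] m := fun k =>
    (Finsupp.linearCombination_single F (1 : F) k).trans (one_smul F _)
  have hext : ∀ P : FreeCyclic F p → Prop, P 0 →
      (∀ (k : ℕ) (a : F) v, P v → P (a • basisVec F p k + v)) → ∀ v, P v := by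
    intro P h0 hs v
    refine Finsupp.induction (motive := P) v h0 fun k a v _ _ hv => ?_
    have h1 : (Finsupp.single k a : ℕ →₀ F) = a • Finsupp.single k (1 : F) := by simp
    rw [h1]
    exact hs k a v hv
  have hgm : ∀ v k, ⁅(pMap F p)^[k] m, g v⁆ = 0 := by
    intro v k
    refine hext (fun v => ⁅(pMap F p)^[k] m, g v⁆ = 0) (by simp) ?_ v
    intro j a v hv
    rw [map_add, map_smul, hg, lie_add, lie_smul, hcomm, hv, smul_zero, add_zero]
  have hgg : ∀ v w, ⁅g v, g w⁆ = 0 := by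
    intro v w
    refine hext (fun v => ⁅g v, g w⁆ = 0) (by simp) ?_ v
    intro j a v hv
    rw [map_add, map_smul, hg, add_lie, smul_lie, hgm, hv, smul_zero, add_zero]
  have hadd : ∀ {N : Type _} [LieRing N] [LieAlgebra F N] [RestrictedLieAlgebra F p N]
      (x y : N), ⁅y, x⁆ = 0 → pMap F p (x + y) = pMap F p x + pMap F p y := by
    intro N _ _ _ x y h
    rw [pMap_add, Finset.sum_eq_zero fun i hi => jacobsonTerm_eq_zero h hi, add_zero]
  have hadd' : ∀ x y : FreeCyclic F p, pMap F p (x + y) = pMap F p x + pMap F p y := by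
    intro x y
    rw [pMap_add, Finset.sum_eq_zero fun i hi => jacobsonTerm_eq_zero (lie_eq_zero y x) hi,
      add_zero]
  have hz : ∀ {N : Type _} [LieRing N] [LieAlgebra F N] [RestrictedLieAlgebra F p N],
      pMap F p (0 : N) = 0 := by
    intro N _ _ _
    have := pMap_smul (F := F) (p := p) 0 (0 : N)
    rwa [zero_smul, zero_pow hp, zero_smul] at this
  have hz' : pMap F p (0 : FreeCyclic F p) = 0 := by
    have := pMap_smul (F := F) (p := p) 0 (0 : FreeCyclic F p)
    rwa [zero_smul, zero_pow hp, zero_smul] at this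
  have hgp : ∀ v, g (pMap F p v) = pMap F p (g v) := by
    intro v
    refine hext (fun v => g (pMap F p v) = pMap F p (g v)) ?_ ?_ v
    · rw [hz', map_zero, hz]
    · intro k a v hv
      rw [hadd', map_add, map_add, hadd _ _ (hgg _ _), hv, pMap_smul, map_smul, map_smul,
        pMap_smul, pMap_basisVec, hg, hg, Function.iterate_succ_apply']
  refine ⟨{ g with map_lie' := fun {v w} => ?_ }, ⟨hgp, hg 0⟩, ?_⟩
  · exact (map_zero g).trans (hgg v w).symm
  · rintro f ⟨hf1, hf2⟩
    have hfb : ∀ k, f (basisVec F p k) = (pMap F p)^[k] m := by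
      intro k
      induction k with
      | zero => exact hf2
      | succ k ih => rw [← pMap_basisVec, hf1, ih, Function.iterate_succ_apply']
    refine LieHom.ext fun v => ?_
    change f v = g v
    refine hext (fun v => f v = g v) (by simp) ?_ v
    intro k a v hv
    rw [map_add, map_add, map_smul, map_smul, hv, hfb, hg]

end FreeCyclic

/-! ### Skew polynomials and cyclic quotients -/

section Skew

variable (F : Type*) (p : ℕ) [Field F] [Fact p.Prime] [CharP F p]

/-- The action of `Multiplicative ℕ` on `F` whose generator acts as the Frobenius endomorphism
`σ`. It gives `SkewPolynomial F` the ring structure of `F[t, σ]`. -/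
@[reducible] def frobeniusAction : MulSemiringAction (Multiplicative ℕ) F where
  smul n a := a ^ p ^ n.toAdd
  one_smul a := by
    change a ^ p ^ 0 = a
    simp
  mul_smul m n a := by
    change a ^ p ^ (m.toAdd + n.toAdd) = (a ^ p ^ n.toAdd) ^ p ^ m.toAdd
    rw [← pow_mul, ← pow_add, add_comm]
  smul_zero n := zero_pow (pow_ne_zero _ (Fact.out : p.Prime).ne_zero)
  smul_add n a b := add_pow_char_pow a b p n.toAdd
  smul_one n := one_pow _
  smul_mul n a b := mul_pow a b _

/-- The defining relation `t α = α ^ p t` of `F[t, σ]`. -/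
theorem skewPolynomial_X_mul_C (a : F) :
    letI := frobeniusAction F p
    (SkewPolynomial.X * SkewPolynomial.C a : SkewPolynomial F)
      = SkewPolynomial.C (a ^ p) * SkewPolynomial.X := by
  let _ := frobeniusAction F p
  have h : (SkewPolynomial.φ a : F) = a ^ p := by
    change a ^ p ^ 1 = a ^ p
    rw [pow_one]
  rw [← SkewPolynomial.monomial_zero_left, SkewPolynomial.X_mul_monomial, h,
    ← SkewPolynomial.monomial_zero_left, SkewPolynomial.monomial_mul_X]

/-- `f` is an irreducible element of the ring `F[t, σ]`. -/
def IsIrreducibleSkew (f : SkewPolynomial F) : Prop :=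
  letI := frobeniusAction F p
  Irreducible f

/-- For `f = ∑ α_k t ^ k` in `F[t, σ]`, the element `f̄ = ∑ α_k x^[p]^k` of `𝓛`. -/
noncomputable def skewBar (f : SkewPolynomial F) : FreeCyclic F p :=
  f.sum fun k a => a • (pMap F p)^[k] (FreeCyclic.gen F p)

/-- The restricted Lie algebra `𝓛 / ⟨f̄⟩_p`. -/
abbrev CyclicQuotient (f : SkewPolynomial F) : Type _ :=
  (RestrictedSubalgebra.span {skewBar F p f} : RestrictedSubalgebra F p (FreeCyclic F p)).Quotient
    (FreeCyclic.isIdeal F p _)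

end Skew

/-! Let A be maximal among the abelian ideals of L. It contains the centre, and p-th powers of
elements of A are central because (ad a)^2 = 0, so A is restricted. Dual atomisticity enters through
one trick: a maximal restricted subalgebra M that misses an element of a restricted ideal I
satisfies L = I + M, so elements of L can be moved into M modulo I (`IsCoatom.exists_add_eq`). This
shows that A is its own centralizer (`exists_self_centralizing`, the place where solvability is
used), that restricted subalgebras of A are ideals (`isIdeal_of_le`) and that they have complements
(`exists_complement`). Hence A is a direct sum of minimal restricted subalgebras P.

An abelian restricted Lie algebra is a left F[t,σ]-module on which t acts as the p-map. Left ideals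
of F[t,σ] are principal over any F, so each P is the quotient of F[t,σ] by the left ideal of an
irreducible f (`exists_equiv_cyclicQuotient`).

If the p-map is nonzero on P, then P meets the centre and so is central. Otherwise P is a line, and
L acts on all such lines by one character χ (`exists_character`). When L is not abelian such a line
exists, and ker χ = A because A is self-centralizing, so A has codimension one. A complement is
spanned by some b with χ(b) = 1, and comparing ad b^[p] with (ad b)^p on an eigenvector gives b^[p]
= b (`exists_isToral`). When L is abelian, A = L. -/

/-! ### Skew polynomials over a field: degrees and left ideals. -/

namespace SkewPolynomial

variable {K : Type*} [Field K]

/-- A nonzero skew polynomial has a leading coefficient. -/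
theorem exists_leading {f : SkewPolynomial K} (hf : f ≠ 0) :
    ∃ n, f.coeff n ≠ 0 ∧ ∀ m, n < m → f.coeff m = 0 := by
  have h : f.support.Nonempty := by
    rwa [Finset.nonempty_iff_ne_empty, Ne, support_eq_empty]
  refine ⟨f.support.max' h, mem_support_iff.1 (f.support.max'_mem h), fun m hm => ?_⟩
  by_contra h'
  exact absurd (f.support.le_max' m (mem_support_iff.2 h')) (by omega)

variable [MulSemiringAction (Multiplicative ℕ) K]

open Multiplicative in
theorem coeff_mul_eq_sum_antidiagonal (f g : SkewPolynomial K) (n : ℕ) :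
    (f * g).coeff n =
      ∑ ij ∈ Finset.HasAntidiagonal.antidiagonal n, f.coeff ij.1 * (ofAdd ij.1 • g.coeff ij.2) := by
  have h := SkewMonoidAlgebra.coeff_mul_antidiagonal_of_finset f g (ofAdd n)
    ((Finset.HasAntidiagonal.antidiagonal n).map (ofAdd.prodCongr ofAdd).toEmbedding) (by
      rintro ⟨a, b⟩
      simp only [Finset.mem_map_equiv, Finset.HasAntidiagonal.mem_antidiagonal]
      exact Iff.rfl)
  refine h.trans ?_
  rw [Finset.sum_map]
  rfl

theorem smul_ne_zero_of_ne_zero (m : Multiplicative ℕ) {a : K} (ha : a ≠ 0) : m • a ≠ 0 :=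
  fun h => ha ((MulSemiringAction.toRingHom (Multiplicative ℕ) K m).injective
    (h.trans (smul_zero m).symm))

open Multiplicative in
-- Only the pair (m, n) contributes. The twist on the second factor is harmless, since an
-- endomorphism of a field is injective; so degrees add and the ring is a domain.
theorem coeff_mul_add_of_leading {f g : SkewPolynomial K} {m n : ℕ}
    (hf : ∀ i, m < i → f.coeff i = 0) (hg : ∀ i, n < i → g.coeff i = 0) :
    (f * g).coeff (m + n) = f.coeff m * (ofAdd m • g.coeff n) := by
  rw [coeff_mul_eq_sum_antidiagonal]
  refine Finset.sum_eq_single (m, n) (fun ij hij hne => ?_) (by simp)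
  rw [Finset.HasAntidiagonal.mem_antidiagonal] at hij
  rcases lt_or_ge m ij.1 with h | h
  · rw [hf _ h, zero_mul]
  · rw [hg ij.2, smul_zero, mul_zero]
    by_contra h'
    exact hne (Prod.ext (by dsimp only; omega) (by dsimp only; omega))

theorem coeff_mul_eq_zero_of_lt {f g : SkewPolynomial K} {m n : ℕ}
    (hf : ∀ i, m < i → f.coeff i = 0) (hg : ∀ i, n < i → g.coeff i = 0) {i : ℕ}
    (hi : m + n < i) : (f * g).coeff i = 0 := by
  rw [coeff_mul_eq_sum_antidiagonal]
  refine Finset.sum_eq_zero fun ij hij => ?_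
  rw [Finset.HasAntidiagonal.mem_antidiagonal] at hij
  rcases lt_or_ge m ij.1 with h | h
  · rw [hf _ h, zero_mul]
  · rw [hg ij.2 (by omega), smul_zero, mul_zero]

instance : NoZeroDivisors (SkewPolynomial K) where
  eq_zero_or_eq_zero_of_mul_eq_zero {f g} h := by
    by_contra! hfg
    obtain ⟨m, hm, hm'⟩ := exists_leading hfg.1
    obtain ⟨n, hn, hn'⟩ := exists_leading hfg.2
    have := coeff_mul_add_of_leading hm' hn'
    rw [h, coeff_zero] at this
    exact mul_ne_zero hm (smul_ne_zero_of_ne_zero _ hn) this.symm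

/-- Every left ideal of a skew polynomial ring over a field is principal. -/
theorem exists_eq_span_singleton (I : Submodule (SkewPolynomial K) (SkewPolynomial K)) :
    ∃ f, I = Submodule.span (SkewPolynomial K) {f} := by
  classical
  by_cases hI : I = ⊥
  · exact ⟨0, by rw [hI, Submodule.span_zero_singleton]⟩
  have hex : ∃ n, ∃ f ∈ I, f.coeff n ≠ 0 ∧ ∀ m, n < m → f.coeff m = 0 := by
    obtain ⟨f, hf, hf0⟩ := I.ne_bot_iff.1 hI
    obtain ⟨n, hn⟩ := exists_leading hf0
    exact ⟨n, f, hf, hn⟩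
  obtain ⟨f, hf, hfd, hfz⟩ := Nat.find_spec hex
  set d := Nat.find hex
  refine ⟨f, le_antisymm ?_ ((Submodule.span_singleton_le_iff_mem f I).2 hf)⟩
  -- Division by f on the right, where f has least degree d in I; induction on a degree bound for g.
  have key : ∀ N, ∀ g ∈ I, (∀ i, N ≤ i → g.coeff i = 0) →
      g ∈ Submodule.span (SkewPolynomial K) {f} := by
    intro N
    induction N with
    | zero =>
      intro g _ hg
      have : g = 0 := SkewPolynomial.ext fun i => hg i (Nat.zero_le _)
      rw [this]
      exact zero_mem _
    | succ N ih =>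
      intro g hgI hg
      by_cases hN : g.coeff N = 0
      · refine ih g hgI fun i hi => ?_
        rcases hi.eq_or_lt with rfl | h
        · exact hN
        · exact hg i h
      have hdN : d ≤ N := Nat.find_min' hex ⟨g, hgI, hN, hg⟩
      obtain ⟨k, rfl⟩ := Nat.exists_eq_add_of_le' hdN
      -- Chosen so that c t^k f and g have the same leading term. Only an inverse in K is needed,
      -- not one of σ, so K need not be perfect.
      set c : K := g.coeff (k + d) * (Multiplicative.ofAdd k • f.coeff d)⁻¹
      have hmon : ∀ i, k < i → (monomial k c).coeff i = 0 := fun i hi => by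
        rw [coeff_monomial, if_neg hi.ne]
      have hmem : monomial k c * f ∈ Submodule.span (SkewPolynomial K) {f} :=
        Submodule.mem_span_singleton.2 ⟨_, rfl⟩
      have hsub : ∀ (u v : SkewPolynomial K) i, (u - v).coeff i = u.coeff i - v.coeff i :=
        fun u v i =>
        DFunLike.congr_fun (SkewMonoidAlgebra.coeff_sub u v) (Multiplicative.ofAdd i)
      rw [← sub_add_cancel g (monomial k c * f)]
      refine add_mem (ih _ (sub_mem hgI (I.smul_mem _ hf)) fun i hi => ?_) hmem
      rw [hsub]
      rcases hi.eq_or_lt with rfl | h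
      · rw [coeff_mul_add_of_leading hmon hfz, coeff_monomial, if_pos rfl,
          inv_mul_cancel_right₀ (smul_ne_zero_of_ne_zero _ hfd), sub_self]
      · rw [hg i h, coeff_mul_eq_zero_of_lt hmon hfz h, sub_zero]
  intro g hg
  by_cases hg0 : g = 0
  · rw [hg0]
    exact zero_mem _
  · obtain ⟨n, -, hn⟩ := exists_leading hg0
    exact key (n + 1) g hg fun i hi => hn i hi

end SkewPolynomial

/-! ### The action of F[t,σ] through the p-map. -/

section SkewAct

variable {F : Type*} {p : ℕ} [Field F] [Fact p.Prime] {L M : Type*} [LieRing L] [LieAlgebra F L]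
  [RestrictedLieAlgebra F p L] [LieRing M] [LieAlgebra F M] [RestrictedLieAlgebra F p M]

variable (F p) in
theorem pMap_zero : pMap F p (0 : L) = 0 := by
  have := pMap_smul (F := F) (p := p) 0 (0 : L)
  rwa [zero_smul, zero_pow (Fact.out : p.Prime).ne_zero, zero_smul] at this

omit [Fact p.Prime] in
variable (F p) in
theorem pMap_add_of_lie_eq_zero {x y : L} (h : ⁅y, x⁆ = 0) :
    pMap F p (x + y) = pMap F p x + pMap F p y := by
  rw [pMap_add, Finset.sum_eq_zero fun i hi => jacobsonTerm_eq_zero h hi, add_zero]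

variable (F p) in
theorem pMap_iterate_zero (k : ℕ) : (pMap F p)^[k] (0 : L) = 0 :=
  Function.iterate_fixed (pMap_zero F p) k

omit [Fact p.Prime] in
theorem pMap_iterate_smul (k : ℕ) (a : F) (x : L) :
    (pMap F p)^[k] (a • x) = a ^ p ^ k • (pMap F p)^[k] x := by
  induction k with
  | zero => simp
  | succ k ih => rw [Function.iterate_succ_apply', ih, pMap_smul, Function.iterate_succ_apply',
      ← pow_mul, pow_succ]

variable (F p) in
/-- The action of `F[t, σ]` on a restricted Lie algebra, where `t` acts as the `p`-map. -/
noncomputable def skewAct (f : SkewPolynomial F) (v : L) : L :=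
  f.sum fun k a => a • (pMap F p)^[k] v

omit [Fact p.Prime] in
theorem skewAct_add (f g : SkewPolynomial F) (v : L) :
    skewAct F p (f + g) v = skewAct F p f v + skewAct F p g v :=
  SkewMonoidAlgebra.sum_add_index' (fun _ => zero_smul F _) (fun _ _ _ => add_smul _ _ _)

omit [Fact p.Prime] in
theorem skewAct_zero (v : L) : skewAct F p 0 v = 0 := by
  have := skewAct_add (p := p) (0 : SkewPolynomial F) 0 v
  simpa using this

omit [Fact p.Prime] in
theorem skewAct_monomial (k : ℕ) (a : F) (v : L) :
    skewAct F p (SkewPolynomial.monomial k a) v = a • (pMap F p)^[k] v :=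
  SkewPolynomial.sum_monomial_index (zero_smul F _)

omit [Fact p.Prime] in
theorem skewAct_neg (f : SkewPolynomial F) (v : L) : skewAct F p (-f) v = -skewAct F p f v := by
  have := skewAct_add (p := p) (-f) f v
  rw [neg_add_cancel, skewAct_zero] at this
  exact eq_neg_of_add_eq_zero_left this.symm

omit [Fact p.Prime] in
theorem skewAct_mem (S : RestrictedSubalgebra F p L) (f : SkewPolynomial F) {v : L}
    (hv : v ∈ S) : skewAct F p f v ∈ S := by
  have hk : ∀ k, (pMap F p)^[k] v ∈ S := by
    intro k
    induction k with
    | zero => exact hv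
    | succ k ih =>
      rw [Function.iterate_succ_apply']
      exact S.pMap_mem' ih
  induction f using SkewPolynomial.induction with
  | h0 => rw [skewAct_zero]; exact S.toLieSubalgebra.zero_mem
  | ha n r q _ _ ih =>
    rw [skewAct_add, skewAct_monomial]
    exact S.toLieSubalgebra.add_mem (S.toLieSubalgebra.smul_mem r (hk n)) ih

omit [Fact p.Prime] in
theorem map_skewAct (φ : L →ₗ⁅F⁆ M) (hφ : ∀ v, φ (pMap F p v) = pMap F p (φ v))
    (f : SkewPolynomial F) (v : L) : φ (skewAct F p f v) = skewAct F p f (φ v) := by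
  have hk : ∀ k, φ ((pMap F p)^[k] v) = (pMap F p)^[k] (φ v) := by
    intro k
    induction k with
    | zero => rfl
    | succ k ih => rw [Function.iterate_succ_apply', hφ, ih, Function.iterate_succ_apply']
  induction f using SkewPolynomial.induction with
  | h0 => rw [skewAct_zero, skewAct_zero, map_zero]
  | ha n r q _ _ ih =>
    rw [skewAct_add, skewAct_add, skewAct_monomial, skewAct_monomial, map_add, map_smul, hk, ih]

section Abelian

variable [IsLieAbelian L]

omit [Fact p.Prime] in
variable (F p) in
theorem pMap_iterate_add (k : ℕ) (x y : L) :
    (pMap F p)^[k] (x + y) = (pMap F p)^[k] x + (pMap F p)^[k] y := by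
  induction k with
  | zero => rfl
  | succ k ih =>
    simp only [Function.iterate_succ_apply']
    rw [ih, pMap_add_of_lie_eq_zero F p (trivial_lie_zero L L _ _)]

/-- On an abelian algebra the p-map is additive and σ-semilinear, which is the relation t α = α^p t;
additivity reduces the claim to monomials. -/
theorem skewAct_mul [CharP F p] (f g : SkewPolynomial F) (v : L) :
    letI := frobeniusAction F p
    skewAct F p (f * g) v = skewAct F p f (skewAct F p g v) := by
  let _ := frobeniusAction F p
  change skewAct F p (f * g) v = skewAct F p f (skewAct F p g v)
  induction f using SkewPolynomial.induction with
  | h0 => rw [zero_mul, skewAct_zero, skewAct_zero]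
  | ha n r q _ _ ih =>
    rw [add_mul, skewAct_add, ih, skewAct_add, skewAct_monomial]
    congr 1
    clear ih
    induction g using SkewPolynomial.induction with
    | h0 => rw [mul_zero, skewAct_zero, pMap_iterate_zero, smul_zero]
    | ha m s q _ _ ih =>
      have hs : (SkewPolynomial.φ^[n] s : F) = s ^ p ^ n := SkewPolynomial.φ_iterate_apply n s
      rw [mul_add, skewAct_add, ih, skewAct_add, pMap_iterate_add, smul_add,
        skewAct_monomial, SkewPolynomial.monomial_mul_monomial, skewAct_monomial, hs, pMap_iterate_smul, mul_smul,
        Function.iterate_add_apply]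

end Abelian

end SkewAct

/-! ### Simple abelian restricted Lie algebras as cyclic quotients. -/

section Cyclic

variable {F : Type*} {p : ℕ} [Field F] [Fact p.Prime] [CharP F p]

instance : IsLieAbelian (FreeCyclic F p) := ⟨fun _ _ => rfl⟩

theorem skewBar_eq_skewAct (f : SkewPolynomial F) :
    skewBar F p f = skewAct F p f (FreeCyclic.gen F p) := rfl

theorem pMap_iterate_gen (k : ℕ) :
    (pMap F p)^[k] (FreeCyclic.gen F p) = FreeCyclic.basisVec F p k := by
  induction k with
  | zero => rfl
  | succ k ih => rw [Function.iterate_succ_apply', ih, FreeCyclic.pMap_basisVec]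

theorem skewBar_surjective : Function.Surjective (skewBar F p) := by
  intro v
  refine Finsupp.induction (motive := fun v => ∃ f, skewBar F p f = v) v
    ⟨0, skewAct_zero _⟩ ?_
  rintro k a w - - ⟨f, hf⟩
  refine ⟨SkewPolynomial.monomial k a + f, ?_⟩
  rw [skewBar_eq_skewAct, skewAct_add, ← skewBar_eq_skewAct f, hf, skewAct_monomial,
    pMap_iterate_gen]
  congr 1
  exact (Finsupp.smul_single' a k 1).trans (by rw [mul_one])

variable {M : Type*} [LieRing M] [LieAlgebra F M] [RestrictedLieAlgebra F p M] [IsLieAbelian M]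

variable (F p) in
/-- The restricted subalgebra generated by an element of an abelian restricted Lie algebra. -/
noncomputable def skewOrbit (m : M) : RestrictedSubalgebra F p M where
  carrier := Set.range fun f => skewAct F p f m
  add_mem' := by
    rintro _ _ ⟨f, rfl⟩ ⟨g, rfl⟩
    exact ⟨f + g, skewAct_add f g m⟩
  zero_mem' := ⟨0, skewAct_zero m⟩
  smul_mem' := by
    rintro a _ ⟨f, rfl⟩
    let _ := frobeniusAction F p
    refine ⟨SkewPolynomial.monomial 0 a * f, ?_⟩
    exact (skewAct_mul _ f m).trans (skewAct_monomial 0 a _)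
  lie_mem' := by
    rintro x y - -
    exact ⟨0, (skewAct_zero m).trans (trivial_lie_zero M M x y).symm⟩
  pMap_mem' := by
    rintro _ ⟨f, rfl⟩
    let _ := frobeniusAction F p
    refine ⟨SkewPolynomial.monomial 1 1 * f, ?_⟩
    exact (skewAct_mul _ f m).trans ((skewAct_monomial 1 1 _).trans (one_smul F _))

theorem mem_skewOrbit_self (m : M) : m ∈ skewOrbit F p m :=
  ⟨SkewPolynomial.monomial 0 1, (skewAct_monomial 0 1 _).trans (one_smul F _)⟩

/-- The annihilator of an element of an abelian restricted Lie algebra, as a left ideal of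
`F[t, σ]`. -/
def skewAnnihilator (F : Type*) (p : ℕ) [Field F] [Fact p.Prime] [CharP F p] {M : Type*}
    [LieRing M] [LieAlgebra F M] [RestrictedLieAlgebra F p M] [IsLieAbelian M] (m : M) :
    letI := frobeniusAction F p
    Submodule (SkewPolynomial F) (SkewPolynomial F) :=
  letI := frobeniusAction F p
  { carrier := {f | skewAct F p f m = 0}
    add_mem' := fun {f g} hf hg => by
      change skewAct F p (f + g) m = 0
      rw [skewAct_add, hf, hg, add_zero]
    zero_mem' := skewAct_zero m
    smul_mem' := fun g f hf => by
      refine (skewAct_mul g f m).trans ?_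
      rw [hf]
      have := skewAct_mul (p := p) g 0 m
      rwa [mul_zero, skewAct_zero, eq_comm] at this }

/-- The annihilator is a principal left ideal. Were its generator zero, the homomorphism from 𝓛
sending x to m would embed an infinite-dimensional space in M. -/
theorem exists_annihilator_generator [FiniteDimensional F M] (m : M) :
    letI := frobeniusAction F p
    ∃ f : SkewPolynomial F, f ≠ 0 ∧ ∀ h, skewAct F p h m = 0 ↔ ∃ u, h = u * f := by
  let _ := frobeniusAction F p
  obtain ⟨f, hf⟩ := SkewPolynomial.exists_eq_span_singleton (skewAnnihilator F p m)
  have hmem : ∀ h, skewAct F p h m = 0 ↔ ∃ u, h = u * f := by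
    intro h
    change h ∈ skewAnnihilator F p m ↔ _
    rw [hf, Submodule.mem_span_singleton]
    exact exists_congr fun u => eq_comm
  refine ⟨f, ?_, hmem⟩
  rintro rfl
  obtain ⟨φ, ⟨hφp, hφ⟩, -⟩ := FreeCyclic.existsUnique_hom F p m
  have hinj : Function.Injective (φ : FreeCyclic F p →ₗ[F] M) := by
    rw [← LinearMap.ker_eq_bot, LinearMap.ker_eq_bot']
    intro v hv
    obtain ⟨h, rfl⟩ := skewBar_surjective v
    change φ (skewBar F p h) = 0 at hv
    rw [skewBar_eq_skewAct, map_skewAct φ hφp, hφ, hmem] at hv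
    obtain ⟨u, hu⟩ := hv
    rw [mul_zero] at hu
    rw [hu]
    exact skewAct_zero _
  have hfin : Module.Finite F (ℕ →₀ F) :=
    Module.Finite.of_injective (show (ℕ →₀ F) →ₗ[F] M from (φ : FreeCyclic F p →ₗ[F] M)) hinj
  exact not_finite_iff_infinite.2 inferInstance
    (Module.Finite.finite_basis (Finsupp.basisSingleOne (R := F) (ι := ℕ)))

/-- Let f = gh. If h kills m, then h is a left multiple of f and cancelling h makes g a unit. If
not, h m generates M by simplicity, and carrying it back to m makes h a unit. -/
theorem IsIrreducibleSkew.of_annihilator {m : M} (hm : m ≠ 0)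
    (hM : ∀ T : RestrictedSubalgebra F p M, (∃ x ∈ T, x ≠ 0) → ∀ y, y ∈ T)
    {f : SkewPolynomial F} (hf0 : f ≠ 0)
    (hf : letI := frobeniusAction F p; ∀ h, skewAct F p h m = 0 ↔ ∃ u, h = u * f) :
    IsIrreducibleSkew F p f := by
  let _ := frobeniusAction F p
  have hmul : ∀ (f g : SkewPolynomial F) (v : M),
    skewAct F p (f * g) v = skewAct F p f (skewAct F p g v) := skewAct_mul
  have hf : ∀ h, skewAct F p h m = 0 ↔ ∃ u, h = u * f := hf
  have hone : skewAct F p 1 m = m := (skewAct_monomial 0 1 m).trans (one_smul F m)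
  -- In a domain a one-sided inverse is two-sided: (gu - 1)g = 0.
  have hunit : ∀ u g : SkewPolynomial F, u * g = 1 → IsUnit u ∧ IsUnit g := by
    intro u g h
    have hg : g ≠ 0 := right_ne_zero_of_mul_eq_one h
    have h' : g * u = 1 := by
      have : (g * u - 1) * g = 0 := by
        rw [sub_mul, mul_assoc, h, mul_one, one_mul, sub_self]
      exact sub_eq_zero.1 ((mul_eq_zero.1 this).resolve_right hg)
    exact ⟨⟨⟨u, g, h, h'⟩, rfl⟩, ⟨⟨g, u, h', h⟩, rfl⟩⟩
  change Irreducible f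
  refine ⟨?_, ?_⟩
  · rintro ⟨u, rfl⟩
    have h1 : skewAct F p 1 m = 0 := (hf 1).2 ⟨_, u.inv_mul.symm⟩
    exact hm (hone.symm.trans h1)
  · rintro g h rfl
    by_cases hh : skewAct F p h m = 0
    · left
      obtain ⟨u, hu⟩ := (hf h).1 hh
      have h0 : h ≠ 0 := right_ne_zero_of_mul hf0
      have : (u * g - 1) * h = 0 := by
        rw [sub_mul, mul_assoc, ← hu, one_mul, sub_self]
      exact (hunit u g (sub_eq_zero.1 ((mul_eq_zero.1 this).resolve_right h0))).2
    · right
      obtain ⟨u, hu⟩ : ∃ u, skewAct F p u (skewAct F p h m) = m :=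
        hM (skewOrbit F p (skewAct F p h m)) ⟨_, mem_skewOrbit_self _, hh⟩ m
      have h1 : skewAct F p (u * h - 1) m = 0 := by
        rw [sub_eq_add_neg, skewAct_add, hmul, hu, skewAct_neg, hone, add_neg_cancel]
      obtain ⟨w, hw⟩ := (hf _).1 h1
      -- Here uh - 1 = w(gh), so u - wg is a left inverse of h.
      refine (hunit (u - w * g) h ?_).2
      rw [sub_mul, mul_assoc, ← hw, sub_sub_cancel]

/-- A simple finite-dimensional abelian restricted Lie algebra is a quotient of the free cyclic
one by an irreducible skew polynomial. -/
theorem exists_equiv_cyclicQuotient [FiniteDimensional F M] [Nontrivial M]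
    (hM : ∀ T : RestrictedSubalgebra F p M, (∃ x ∈ T, x ≠ 0) → ∀ y, y ∈ T) :
    ∃ f : SkewPolynomial F, IsIrreducibleSkew F p f ∧
      Nonempty (RestrictedLieEquiv F p M (CyclicQuotient F p f)) := by
  let _ := frobeniusAction F p
  obtain ⟨m, hm⟩ := exists_ne (0 : M)
  obtain ⟨f, hf0, hf⟩ := exists_annihilator_generator (F := F) (p := p) m
  refine ⟨f, .of_annihilator hm hM hf0 hf, ?_⟩
  obtain ⟨φ, ⟨hφp, hφ⟩, -⟩ := FreeCyclic.existsUnique_hom F p m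
  have hφbar : ∀ h, φ (skewBar F p h) = skewAct F p h m := fun h => by
    rw [skewBar_eq_skewAct, map_skewAct φ hφp, hφ]
  let K : RestrictedSubalgebra F p (FreeCyclic F p) := RestrictedSubalgebra.span {skewBar F p f}
  -- The kernel is a restricted subalgebra containing f̄, hence contains everything f̄ generates.
  let kerφ : RestrictedSubalgebra F p (FreeCyclic F p) :=
    { φ.ker.toLieSubalgebra with
      pMap_mem' := fun {x} hx => by
        have hx : φ x = 0 := hx
        change φ (pMap F p x) = 0
        rw [hφp, hx, pMap_zero] }
  have hK : ∀ v ∈ K, φ v = 0 := by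
    intro v hv
    refine hv kerφ ?_
    rintro _ rfl
    exact (hφbar f).trans ((hf f).2 ⟨1, (one_mul f).symm⟩)
  let I := K.toLieIdeal (FreeCyclic.isIdeal F p K)
  let θ : CyclicQuotient F p f →ₗ[F] M :=
    Submodule.liftQ I.toSubmodule (φ : FreeCyclic F p →ₗ[F] M) hK
  have hθ : ∀ v, θ (quotientMk I v) = φ v := fun v => rfl
  have hbij : Function.Bijective θ := by
    constructor
    · rw [← LinearMap.ker_eq_bot, LinearMap.ker_eq_bot']
      intro x hx
      obtain ⟨v, rfl⟩ := quotientMk_surjective I x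
      obtain ⟨h, rfl⟩ := skewBar_surjective v
      rw [hθ, hφbar] at hx
      -- An element of the kernel comes from a left multiple of f, and u acting on f̄ stays in
      -- ⟨f̄⟩_p.
      obtain ⟨u, rfl⟩ := (hf h).1 hx
      rw [← map_zero (quotientMk I), quotientMk_eq_iff, sub_zero, skewBar_eq_skewAct]
      change _ ∈ K
      rw [skewAct_mul]
      exact skewAct_mem K u fun S hS => hS rfl
    · intro y
      obtain ⟨u, hu⟩ : ∃ u, skewAct F p u m = y :=
        hM (skewOrbit F p m) ⟨m, mem_skewOrbit_self m, hm⟩ y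
      exact ⟨quotientMk I (skewBar F p u), (hθ _).trans ((hφbar u).trans hu)⟩
  have hab : ∀ x y : CyclicQuotient F p f, ⁅x, y⁆ = 0 := by
    intro x y
    obtain ⟨v, rfl⟩ := quotientMk_surjective I x
    obtain ⟨w, rfl⟩ := quotientMk_surjective I y
    rw [← LieHom.map_lie, FreeCyclic.lie_eq_zero, map_zero]
  have hθp : ∀ x, θ (pMap F p x) = pMap F p (θ x) := by
    intro x
    obtain ⟨v, rfl⟩ := quotientMk_surjective I x
    exact hφp v
  let e := (LinearEquiv.ofBijective θ hbij).symm
  have he : ∀ y, θ (e y) = y := fun y => (LinearEquiv.ofBijective θ hbij).apply_symm_apply y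
  let e' : M ≃ₗ⁅F⁆ CyclicQuotient F p f :=
    { e with
      map_lie' := fun {x y} => by
        refine Eq.trans ?_ (hab _ _).symm
        exact (congrArg e (trivial_lie_zero M M x y)).trans (map_zero e) }
  refine ⟨{ toLieEquiv := e', map_pMap := fun x => hbij.1 ?_ }⟩
  exact (he _).trans ((congrArg (pMap F p) (he x)).symm.trans (hθp (e x)).symm)

end Cyclic

/-! ### Sums, intersections and minimality of restricted subalgebras. -/

/-- Modularity lets a direct decomposition be built one summand at a time. -/
theorem iSupIndep_option_elim {α ι : Type*} [CompleteLattice α] [IsModularLattice α]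
    {a : α} {t : ι → α} (ht : iSupIndep t) (ha : Disjoint a (⨆ i, t i)) :
    iSupIndep fun o : Option ι => o.elim a t := by
  rintro (_ | i)
  · refine ha.mono_right (iSup₂_le ?_)
    rintro (_ | j) hj
    · exact absurd rfl hj
    · exact le_iSup t j
  · have h1 : Disjoint (t i ⊔ ⨆ (j) (_ : j ≠ i), t j) a :=
      ha.symm.mono_left (sup_le (le_iSup t i) (iSup₂_le fun j _ => le_iSup t j))
    have h2 := (ht i).disjoint_sup_right_of_disjoint_sup_left h1
    refine h2.mono_right (iSup₂_le ?_)
    rintro (_ | j) hj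
    · exact le_sup_right
    · exact le_sup_of_le_left (le_iSup₂_of_le j (fun h => hj (congrArg some h)) le_rfl)

namespace RestrictedSubalgebra

variable {F : Type*} {p : ℕ} {L : Type*} [Field F] [LieRing L] [LieAlgebra F L]
  [RestrictedLieAlgebra F p L]

/-- The intersection of two restricted subalgebras. -/
def inter (S T : RestrictedSubalgebra F p L) : RestrictedSubalgebra F p L where
  carrier := {x | x ∈ S ∧ x ∈ T}
  add_mem' hx hy := ⟨S.toLieSubalgebra.add_mem hx.1 hy.1, T.toLieSubalgebra.add_mem hx.2 hy.2⟩
  zero_mem' := ⟨S.toLieSubalgebra.zero_mem, T.toLieSubalgebra.zero_mem⟩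
  smul_mem' a _ hx :=
    ⟨S.toLieSubalgebra.smul_mem a hx.1, T.toLieSubalgebra.smul_mem a hx.2⟩
  lie_mem' hx hy := ⟨S.toLieSubalgebra.lie_mem hx.1 hy.1, T.toLieSubalgebra.lie_mem hx.2 hy.2⟩
  pMap_mem' hx := ⟨S.pMap_mem' hx.1, T.pMap_mem' hx.2⟩

/-- The sum of a restricted ideal and a restricted subalgebra. -/
def idealSup (I : RestrictedSubalgebra F p L) (hI : I.IsIdeal) (S : RestrictedSubalgebra F p L) :
    RestrictedSubalgebra F p L where
  toSubmodule := I.toSubmodule ⊔ S.toSubmodule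
  lie_mem' {x y} hx hy := by
    obtain ⟨a, ha, s, hs, rfl⟩ := Submodule.mem_sup.1 hx
    obtain ⟨b, hb, t, ht, rfl⟩ := Submodule.mem_sup.1 hy
    rw [add_lie, lie_add s, ← add_assoc]
    refine Submodule.add_mem_sup (I.toSubmodule.add_mem ?_ (hI s hb)) (S.lie_mem' hs ht)
    rw [← lie_skew]
    exact I.toSubmodule.neg_mem (hI _ ha)
  pMap_mem' {x} hx := by
    obtain ⟨a, ha, s, hs, rfl⟩ := Submodule.mem_sup.1 hx
    -- With the ideal element in second place, `jacobsonTerm_mem` puts every correction term in the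
    -- ideal.
    rw [add_comm a s, pMap_add, add_assoc, add_comm]
    refine Submodule.add_mem_sup (I.toSubmodule.add_mem (I.pMap_mem' ha) ?_) (S.pMap_mem' hs)
    exact I.toSubmodule.sum_mem fun i hi => jacobsonTerm_mem (I.toLieIdeal hI) ha hi

/-- The line spanned by an element whose image under the `p`-map is zero. -/
def line (x : L) (hx : pMap F p x = 0) : RestrictedSubalgebra F p L where
  toSubmodule := Submodule.span F {x}
  lie_mem' {y z} hy hz := by
    obtain ⟨a, rfl⟩ := Submodule.mem_span_singleton.1 hy
    obtain ⟨b, rfl⟩ := Submodule.mem_span_singleton.1 hz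
    rw [smul_lie, lie_smul, lie_self, smul_zero, smul_zero]
    exact Submodule.zero_mem _
  pMap_mem' {y} hy := by
    obtain ⟨a, rfl⟩ := Submodule.mem_span_singleton.1 hy
    rw [pMap_smul, hx, smul_zero]
    exact Submodule.zero_mem _

theorem mem_line {x y : L} {hx : pMap F p x = 0} : y ∈ line x hx ↔ ∃ a : F, a • x = y :=
  Submodule.mem_span_singleton

/-- The image in `L` of a restricted subalgebra of a restricted subalgebra. -/
def ofSubalgebra {S : RestrictedSubalgebra F p L} (T : RestrictedSubalgebra F p S) :
    RestrictedSubalgebra F p L where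
  toLieSubalgebra := T.toLieSubalgebra.map S.incl
  pMap_mem' := by
    rintro _ ⟨y, hy, rfl⟩
    exact ⟨pMap F p y, T.pMap_mem' hy, rfl⟩

theorem coe_mem_ofSubalgebra {S : RestrictedSubalgebra F p L} {T : RestrictedSubalgebra F p S}
    {x : S} : (x : L) ∈ ofSubalgebra T ↔ x ∈ T := by
  constructor
  · rintro ⟨y, hy, h⟩
    rwa [← (Subtype.ext h : y = x)]
  · intro h
    exact ⟨x, h, rfl⟩

/-- A restricted subalgebra is minimal if it is nonzero and contained in each restricted
subalgebra which meets it nontrivially. -/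
def IsMinimal (S : RestrictedSubalgebra F p L) : Prop :=
  (∃ x ∈ S, x ≠ 0) ∧ ∀ T : RestrictedSubalgebra F p L, (∃ x ∈ S, x ∈ T ∧ x ≠ 0) → S ≤ T

/-- Descent on dimension: a witness T' against minimality makes T ∩ T' nonzero and strictly smaller
than T. -/
theorem exists_isMinimal_le [FiniteDimensional F L] (T : RestrictedSubalgebra F p L)
    (hT : ∃ x ∈ T, x ≠ 0) : ∃ S ≤ T, S.IsMinimal := by
  induction hn : Module.finrank F T.toSubmodule using Nat.strong_induction_on generalizing T with
  | _ n ih =>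
  by_cases hmin : ∀ T' : RestrictedSubalgebra F p L, (∃ x ∈ T, x ∈ T' ∧ x ≠ 0) → T ≤ T'
  · exact ⟨T, le_rfl, hT, hmin⟩
  · push Not at hmin
    obtain ⟨T', ⟨x, hxT, hxT', hx⟩, hle⟩ := hmin
    have hlt : (T.inter T').toSubmodule < T.toSubmodule :=
      lt_of_le_not_ge (fun y hy => hy.1) fun h => hle fun y hy => (h hy).2
    obtain ⟨S, hS, hS'⟩ := ih _ (hn ▸ Submodule.finrank_lt_finrank_of_lt hlt) (T.inter T')
      ⟨x, ⟨hxT, hxT'⟩, hx⟩ rfl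
    exact ⟨S, fun y hy => (hS hy).1, hS'⟩

variable [Fact p.Prime]

variable (F p L) in
/-- The center of a restricted Lie algebra. -/
def center : RestrictedSubalgebra F p L where
  carrier := {x | ∀ z : L, ⁅x, z⁆ = 0}
  add_mem' hx hy z := by rw [add_lie, hx, hy, add_zero]
  zero_mem' z := zero_lie z
  smul_mem' a _ hx z := by rw [smul_lie, hx, smul_zero]
  lie_mem' {x y} hx _ z := by rw [hx y, zero_lie]
  pMap_mem' {x} hx z := by
    have h : LieAlgebra.ad F L x = 0 := LinearMap.ext hx
    rw [lie_pMap, h, zero_pow (Fact.out : p.Prime).ne_zero, LinearMap.zero_apply]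

/-- A minimal restricted subalgebra with commuting elements is a cyclic quotient. -/
theorem IsMinimal.exists_equiv_cyclicQuotient [CharP F p] [FiniteDimensional F L]
    {S : RestrictedSubalgebra F p L} (hS : S.IsMinimal)
    (hab : ∀ x ∈ S, ∀ y ∈ S, ⁅x, y⁆ = 0) :
    ∃ f : SkewPolynomial F, IsIrreducibleSkew F p f ∧
      Nonempty (RestrictedLieEquiv F p S (CyclicQuotient F p f)) := by
  have : IsLieAbelian S := ⟨fun x y => Subtype.ext (hab x x.2 y y.2)⟩
  have : FiniteDimensional F S := inferInstanceAs (FiniteDimensional F S.toSubmodule)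
  obtain ⟨⟨x, hxS, hx⟩, hmin⟩ := hS
  have : Nontrivial S := ⟨⟨⟨x, hxS⟩, 0, fun h => hx (congrArg Subtype.val h)⟩⟩
  refine _root_.exists_equiv_cyclicQuotient ?_
  rintro T ⟨y, hyT, hy⟩ z
  refine coe_mem_ofSubalgebra.1 (hmin (ofSubalgebra T)
    ⟨y, y.2, coe_mem_ofSubalgebra.2 hyT, fun h => hy (Subtype.ext h)⟩ z.2)

end RestrictedSubalgebra

/-! ### Abelian restricted ideals of a dually atomistic algebra. -/

section AbelianIdeals

open RestrictedSubalgebra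

variable {F : Type*} {p : ℕ} {L : Type*} [Field F] [LieRing L] [LieAlgebra F L]
  [RestrictedLieAlgebra F p L]

/-- Since ad a maps L into I and kills I, its square vanishes, and p ≥ 2. -/
theorem lie_pMap_eq_zero [Fact p.Prime] {I : Submodule F L} (hI : ∀ x : L, ∀ y ∈ I, ⁅x, y⁆ ∈ I)
    (hab : ∀ x ∈ I, ∀ y ∈ I, ⁅x, y⁆ = 0) {a : L} (ha : a ∈ I) (z : L) :
    ⁅pMap F p a, z⁆ = 0 := by
  obtain ⟨k, hk⟩ : ∃ k, p = k + 2 :=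
    Nat.exists_eq_add_of_le' (Fact.out : p.Prime).two_le
  have h : ⁅a, z⁆ ∈ I := by
    rw [← lie_skew]
    exact I.neg_mem (hI z a ha)
  rw [lie_pMap, congrArg (LieAlgebra.ad F L a ^ ·) hk, pow_add, pow_two]
  simp only [Module.End.mul_apply, LieAlgebra.ad_apply]
  rw [hab a ha _ h, map_zero]

/-- I + M is a restricted subalgebra strictly above the coatom M, hence is L. -/
theorem IsCoatom.exists_add_eq {M : RestrictedSubalgebra F p L} (hM : IsCoatom M)
    {I : RestrictedSubalgebra F p L} (hI : I.IsIdeal) {z : L} (hzI : z ∈ I) (hzM : z ∉ M) (x : L) :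
    ∃ a ∈ I, ∃ m ∈ M, a + m = x := by
  have hlt : M < I.idealSup hI M := by
    refine lt_of_le_of_ne (fun y hy => (le_sup_right : M.toSubmodule ≤ _) hy) fun h => hzM ?_
    rw [h]
    exact (le_sup_left : I.toSubmodule ≤ _) hzI
  have hx : x ∈ I.idealSup hI M := by
    rw [hM.2 _ hlt]
    exact LieSubalgebra.mem_top x
  exact Submodule.mem_sup.1 hx

namespace IsDuallyAtomistic

theorem exists_isCoatom (hL : IsDuallyAtomistic F p L) {S : RestrictedSubalgebra F p L} {x : L}
    (hx : x ∉ S) : ∃ M : RestrictedSubalgebra F p L, IsCoatom M ∧ S ≤ M ∧ x ∉ M := by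
  obtain ⟨T, hT, hS⟩ := hL S
  have hmem : ∀ y, y ∈ S ↔ ∀ M ∈ T, y ∈ M := by
    intro y
    rw [← SetLike.mem_coe, hS]
    simp
  rw [hmem] at hx
  push Not at hx
  obtain ⟨M, hM, hxM⟩ := hx
  exact ⟨M, hT M hM, fun y hy => (hmem y).1 hy M hM, hxM⟩

theorem exists_isCoatom_of_ne_zero [Fact p.Prime] (hL : IsDuallyAtomistic F p L) {x : L}
    (hx : x ≠ 0) : ∃ M : RestrictedSubalgebra F p L, IsCoatom M ∧ x ∉ M := by
  -- The line through 0 serves as the zero subalgebra.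
  have hx' : x ∉ (line (0 : L) (pMap_zero F p) : RestrictedSubalgebra F p L) := by
    rw [mem_line]
    rintro ⟨a, ha⟩
    exact hx (by rw [← ha, smul_zero])
  obtain ⟨M, hM, -, h⟩ := hL.exists_isCoatom hx'
  exact ⟨M, hM, h⟩

/-- Each restricted subalgebra of an abelian restricted ideal is an ideal. -/
theorem isIdeal_of_le (hL : IsDuallyAtomistic F p L) {I : RestrictedSubalgebra F p L}
    (hI : I.IsIdeal) (hab : ∀ x ∈ I, ∀ y ∈ I, ⁅x, y⁆ = 0) {S : RestrictedSubalgebra F p L}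
    (hS : S ≤ I) : S.IsIdeal := by
  intro x y hy
  by_contra h
  obtain ⟨M, hM, hSM, hxy⟩ := hL.exists_isCoatom h
  -- The bracket lies in I but not in M, so x can be moved modulo I into M. As I commutes with y ∈ S
  -- ≤ M, the bracket is unchanged and lies in M after all.
  obtain ⟨a, ha, m, hm, rfl⟩ := hM.exists_add_eq hI (hI x (hS hy)) hxy x
  refine hxy ?_
  rw [add_lie, hab a ha y (hS hy), zero_add]
  exact M.lie_mem' hm (hSM hy)

/-- A restricted subalgebra of an abelian restricted ideal is complemented in each restricted
subalgebra. -/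
theorem exists_complement [Fact p.Prime] [FiniteDimensional F L] (hL : IsDuallyAtomistic F p L)
    {I : RestrictedSubalgebra F p L} (hI : I.IsIdeal) (hab : ∀ x ∈ I, ∀ y ∈ I, ⁅x, y⁆ = 0)
    {S : RestrictedSubalgebra F p L} (hS : S ≤ I) (T : RestrictedSubalgebra F p L) :
    ∃ T' ≤ T, T.toSubmodule ≤ S.toSubmodule ⊔ T'.toSubmodule ∧
      Disjoint S.toSubmodule T'.toSubmodule := by
  induction hn : Module.finrank F T.toSubmodule using Nat.strong_induction_on generalizing T with
  | _ n ih =>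
  by_cases hST : Disjoint S.toSubmodule T.toSubmodule
  · exact ⟨T, le_rfl, le_sup_right, hST⟩
  · rw [Submodule.disjoint_def] at hST
    push Not at hST
    obtain ⟨z, hzS, hzT, hz⟩ := hST
    -- Cutting T by a coatom that misses z ∈ S ∩ T lowers the dimension. Nothing is lost modulo S: S
    -- ∩ T is an ideal, so L = (S ∩ T) + M and T = (S ∩ T) + (T ∩ M).
    obtain ⟨M, hM, hzM⟩ := hL.exists_isCoatom_of_ne_zero hz
    have hlt : (T.inter M).toSubmodule < T.toSubmodule :=
      lt_of_le_not_ge (fun y hy => hy.1) fun h => hzM (h hzT).2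
    obtain ⟨T', hT', hsup, hdisj⟩ :=
      ih _ (hn ▸ Submodule.finrank_lt_finrank_of_lt hlt) (T.inter M) rfl
    refine ⟨T', fun y hy => (hT' hy).1, fun t ht => ?_, hdisj⟩
    obtain ⟨s, hs, m, hm, rfl⟩ := hM.exists_add_eq
      (hL.isIdeal_of_le hI hab (S := S.inter T) fun y hy => hS hy.1) ⟨hzS, hzT⟩ hzM t
    refine Submodule.add_mem _ ((le_sup_left : S.toSubmodule ≤ _) hs.1) (hsup ⟨?_, hm⟩)
    have := T.toSubmodule.sub_mem ht hs.2
    rwa [add_sub_cancel_left] at this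

/-- An abelian restricted ideal is a direct sum of minimal restricted subalgebras. -/
theorem exists_iSupIndep_isMinimal [Fact p.Prime] [FiniteDimensional F L]
    (hL : IsDuallyAtomistic F p L) {I : RestrictedSubalgebra F p L} (hI : I.IsIdeal)
    (hab : ∀ x ∈ I, ∀ y ∈ I, ⁅x, y⁆ = 0) (T : RestrictedSubalgebra F p L) (hT : T ≤ I) :
    ∃ (ι : Type) (_ : Fintype ι) (P : ι → RestrictedSubalgebra F p L),
      (∀ i, (P i).IsMinimal) ∧ iSupIndep (fun i => (P i).toSubmodule) ∧
      (⨆ i, (P i).toSubmodule) = T.toSubmodule := by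
  induction hn : Module.finrank F T.toSubmodule using Nat.strong_induction_on generalizing T with
  | _ n ih =>
  by_cases hT0 : ∃ x ∈ T, x ≠ 0
  · obtain ⟨S, hST, hS⟩ := T.exists_isMinimal_le hT0
    obtain ⟨T', hT', hsup, hdisj⟩ := hL.exists_complement hI hab (hST.trans hT) T
    have hlt : T'.toSubmodule < T.toSubmodule := by
      refine lt_of_le_not_ge hT' fun h => ?_
      obtain ⟨x, hxS, hx⟩ := hS.1
      exact hx (Submodule.disjoint_def.1 hdisj x hxS (h (hST hxS)))
    obtain ⟨ι, _, P, hP, hind, hsum⟩ :=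
      ih _ (hn ▸ Submodule.finrank_lt_finrank_of_lt hlt) T' (hT'.trans hT) rfl
    have hfun : (fun o : Option ι => (o.elim S P).toSubmodule) =
        fun o => o.elim S.toSubmodule fun i => (P i).toSubmodule := by
      ext1 o
      cases o <;> rfl
    refine ⟨Option ι, inferInstance, fun o => o.elim S P, ?_, ?_, ?_⟩
    · rintro (_ | i)
      · exact hS
      · exact hP i
    · rw [hfun]
      exact iSupIndep_option_elim hind (hsum ▸ hdisj)
    · rw [hfun, iSup_option]
      change S.toSubmodule ⊔ ⨆ i, (P i).toSubmodule = _
      rw [hsum]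
      exact le_antisymm (sup_le hST hT') hsup
  · refine ⟨Empty, inferInstance, fun i => i.elim, fun i => i.elim, fun i => i.elim, ?_⟩
    push Not at hT0
    rw [iSup_of_empty, eq_comm, Submodule.eq_bot_iff]
    exact hT0

/-- A finite-dimensional solvable dually atomistic restricted Lie algebra has a self-centralizing
abelian restricted ideal. -/
theorem exists_self_centralizing [Fact p.Prime] [FiniteDimensional F L]
    [LieAlgebra.IsSolvable L] (hL : IsDuallyAtomistic F p L) :
    ∃ A : RestrictedSubalgebra F p L, A.IsIdeal ∧ (∀ x ∈ A, ∀ y ∈ A, ⁅x, y⁆ = 0) ∧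
      ∀ x : L, (∀ a ∈ A, ⁅x, a⁆ = 0) → x ∈ A := by
  obtain ⟨A, hab, hmax⟩ :=
    (wellFounded_gt : WellFounded ((· > ·) : LieIdeal F L → _ → Prop)).has_min
    {A | ∀ x ∈ A, ∀ y ∈ A, ⁅x, y⁆ = 0} ⟨⊥, by
      rintro x hx y -
      rw [(LieSubmodule.mem_bot x).1 hx, zero_lie]⟩
  have hext : ∀ E : LieIdeal F L, A ≤ E → (∀ x ∈ E, ∀ y ∈ E, ⁅x, y⁆ = 0) → E ≤ A := by
    intro E hAE hE
    by_contra h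
    exact hmax E hE (lt_of_le_not_ge hAE h)
  -- Adding the centre to A keeps it abelian, so maximality applies. As p-th powers from A are
  -- central, A is then closed under the p-map.
  have hcenter : ∀ z : L, (∀ x : L, ⁅z, x⁆ = 0) → z ∈ A := by
    intro z hz
    have hz' : z ∈ LieAlgebra.center F L := by
      rw [LieModule.mem_maxTrivSubmodule]
      intro x
      rw [← lie_skew, hz, neg_zero]
    refine hext (A ⊔ LieAlgebra.center F L) le_sup_left ?_
      ((le_sup_right : LieAlgebra.center F L ≤ _) hz')
    intro x hx y hy
    obtain ⟨a, ha, c, hc, rfl⟩ := (LieSubmodule.mem_sup A _ x).1 hx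
    obtain ⟨b, hb, d, hd, rfl⟩ := (LieSubmodule.mem_sup A _ y).1 hy
    rw [LieModule.mem_maxTrivSubmodule] at hc hd
    rw [lie_add, hd, add_zero, add_lie, hab a ha b hb, zero_add, ← lie_skew, hc, neg_zero]
  let R : RestrictedSubalgebra F p L :=
    { toSubmodule := A.toSubmodule
      lie_mem' := fun {x y} _ hy => A.lie_mem hy
      pMap_mem' := fun {x} hx => hcenter _ (lie_pMap_eq_zero (I := A.toSubmodule)
        (fun x y hy => A.lie_mem hy) hab hx) }
  have hR : R.IsIdeal := fun x y hy => A.lie_mem (x := x) (m := y) hy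
  refine ⟨R, hR, hab, fun x hx => ?_⟩
  let C : LieIdeal F L := LieModule.ker F L A
  have hC : ∀ y : L, y ∈ C ↔ ∀ a ∈ A, ⁅y, a⁆ = 0 := by
    intro y
    rw [LieModule.mem_ker]
    exact ⟨fun h a ha => congrArg Subtype.val (h ⟨a, ha⟩), fun h a => Subtype.ext (h a a.2)⟩
  have hex : ∃ k, LieAlgebra.derivedSeriesOfIdeal F L k C ≤ A := by
    obtain ⟨k, hk⟩ := LieAlgebra.IsSolvable.solvable F L
    refine ⟨k, le_trans (LieAlgebra.derivedSeriesOfIdeal_mono (le_top : C ≤ ⊤) k) ?_⟩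
    change LieAlgebra.derivedSeries F L k ≤ A
    rw [hk]
    exact bot_le
  classical
  cases hk : Nat.find hex with
  | zero =>
    have := Nat.find_spec hex
    rw [hk] at this
    exact this ((hC x).2 hx)
  | succ j =>
    exfalso
    have hspec := Nat.find_spec hex
    rw [hk, LieAlgebra.derivedSeriesOfIdeal_succ] at hspec
    refine Nat.find_min hex (m := j) (by omega) ?_
    -- The last derived term of the centralizer C not contained in A. Once A + D is shown abelian,
    -- maximality of A is contradicted.
    set D := LieAlgebra.derivedSeriesOfIdeal F L j C
    have hDC : D ≤ C := LieAlgebra.derivedSeriesOfIdeal_le_self C j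
    have hEA : ∀ x ∈ A ⊔ D, ∀ a ∈ A, ⁅x, a⁆ = 0 := by
      intro x hx b hb
      obtain ⟨a, ha, d, hd, rfl⟩ := (LieSubmodule.mem_sup A _ x).1 hx
      rw [add_lie, hab a ha b hb, (hC d).1 (hDC hd) b hb, add_zero]
    have hEA' : ∀ x ∈ A ⊔ D, ∀ a ∈ A, ⁅a, x⁆ = 0 := by
      intro x hx b hb
      rw [← lie_skew, hEA x hx b hb, neg_zero]
    have hEE : ∀ x ∈ A ⊔ D, ∀ y ∈ A ⊔ D, ⁅x, y⁆ ∈ A := by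
      intro x hx y hy
      obtain ⟨a, ha, d, hd, rfl⟩ := (LieSubmodule.mem_sup A _ x).1 hx
      obtain ⟨b, hb, e, he, rfl⟩ := (LieSubmodule.mem_sup A _ y).1 hy
      rw [lie_add, hEA _ hx b hb, zero_add, add_lie,
        hEA' e ((le_sup_right : D ≤ A ⊔ D) he) a ha, zero_add]
      exact hspec (LieSubmodule.lie_mem_lie hd he)
    refine le_trans le_sup_right (hext (A ⊔ D) le_sup_left fun x hx y hy => ?_)
    by_contra hxy
    obtain ⟨M, hM, hxyM⟩ := hL.exists_isCoatom_of_ne_zero hxy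
    -- Since A centralizes A + D, moving x and y modulo A into M leaves their bracket unchanged.
    obtain ⟨a, ha, m, hm, rfl⟩ := hM.exists_add_eq hR (hEE x hx y hy) hxyM x
    obtain ⟨b, hb, n, hn, rfl⟩ := hM.exists_add_eq hR (hEE _ hx y hy) hxyM y
    refine hxyM ?_
    have hn' : n ∈ A ⊔ D := by
      have := sub_mem hy ((le_sup_left : A ≤ A ⊔ D) hb)
      rwa [add_sub_cancel_left] at this
    rw [lie_add, hEA _ hx b hb, zero_add, add_lie, hEA' n hn' a ha, zero_add]
    exact M.lie_mem' hm hn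

end IsDuallyAtomistic

end AbelianIdeals

/-- The elements of a finite type can be numbered so that those satisfying a predicate come
first. -/
theorem exists_equiv_fin_lt_iff {ι : Type*} [Fintype ι] (q : ι → Prop) :
    ∃ (n r : ℕ) (e : Fin n ≃ ι), r ≤ n ∧ ∀ i : Fin n, (i : ℕ) < r ↔ q (e i) := by
  classical
  let r := Fintype.card {i // q i}
  let s := Fintype.card {i // ¬ q i}
  refine ⟨r + s, r, finSumFinEquiv.symm.trans (((Fintype.equivFin {i // q i}).symm.sumCongr
    (Fintype.equivFin {i // ¬ q i}).symm).trans (Equiv.sumCompl q)), by omega, fun i => ?_⟩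
  refine Fin.addCases (fun j => ?_) (fun j => ?_) i
  · simpa using iff_of_true j.2 ((Fintype.equivFin {i // q i}).symm j).2
  · simpa using ((Fintype.equivFin {i // ¬ q i}).symm j).2

/-! ### The character on the lines killed by the p-map, and the toral complement. -/

section

open RestrictedSubalgebra

variable {F : Type*} [Field F] {p : ℕ} [Fact p.Prime] {L : Type*} [LieRing L] [LieAlgebra F L]
  [RestrictedLieAlgebra F p L]

namespace RestrictedSubalgebra.IsMinimal

/-- The nonzero element a^[p] of P is central, so minimality puts all of P in the centre. -/
theorem le_center {P : RestrictedSubalgebra F p L} (hP : P.IsMinimal)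
    {A : RestrictedSubalgebra F p L} (hA : A.IsIdeal) (hab : ∀ x ∈ A, ∀ y ∈ A, ⁅x, y⁆ = 0)
    (hPA : P ≤ A) (h : ∃ a ∈ P, pMap F p a ≠ 0) : P ≤ center F p L := by
  obtain ⟨a, ha, ha0⟩ := h
  exact hP.2 _ ⟨pMap F p a, P.pMap_mem' ha,
    lie_pMap_eq_zero (I := A.toSubmodule) (fun x y hy => hA x hy) hab (hPA ha), ha0⟩

omit [Fact p.Prime] in
theorem exists_eq_span {P : RestrictedSubalgebra F p L} (hP : P.IsMinimal)
    (h : ∀ a ∈ P, pMap F p a = 0) :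
    ∃ x : L, x ≠ 0 ∧ x ∈ P ∧ P.toSubmodule = Submodule.span F {x} := by
  obtain ⟨x, hxP, hx⟩ := hP.1
  refine ⟨x, hx, hxP, le_antisymm ?_ ((Submodule.span_singleton_le_iff_mem x _).2 hxP)⟩
  exact hP.2 (line x (h x hxP)) ⟨x, hxP, Submodule.mem_span_singleton_self x, hx⟩

end RestrictedSubalgebra.IsMinimal

omit [Fact p.Prime] in
/-- `L` acts by a single character on the elements of an abelian restricted ideal which are
killed by the `p`-map. -/
theorem IsDuallyAtomistic.exists_character (hL : IsDuallyAtomistic F p L)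
    {A : RestrictedSubalgebra F p L} (hA : A.IsIdeal) (hab : ∀ x ∈ A, ∀ y ∈ A, ⁅x, y⁆ = 0)
    {x₀ : L} (hx₀ : x₀ ≠ 0) (hx₀A : x₀ ∈ A) (hx₀p : pMap F p x₀ = 0) :
    ∃ χ : L →ₗ[F] F, ∀ a ∈ A, pMap F p a = 0 → ∀ z : L, ⁅z, a⁆ = χ z • a := by
  -- The line through a is a restricted subalgebra of A, hence an ideal.
  have hline : ∀ a ∈ A, pMap F p a = 0 → ∀ z : L, ∃ c : F, c • a = ⁅z, a⁆ := by
    intro a ha hap z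
    refine mem_line.1 (hL.isIdeal_of_le hA hab (S := line a hap) ?_ z
      (Submodule.mem_span_singleton_self a))
    exact (Submodule.span_singleton_le_iff_mem a A.toSubmodule).2 ha
  obtain ⟨φ, hφ⟩ : ∃ φ : Module.Dual F L, φ x₀ ≠ 0 := by
    by_contra! h
    exact hx₀ ((Module.forall_dual_apply_eq_zero_iff F x₀).1 h)
  -- The eigenvalue on x₀, read off by a functional so that it is visibly linear in z; the sign
  -- turns [x₀, z] into [z, x₀].
  let χ : L →ₗ[F] F := -((φ x₀)⁻¹ • φ ∘ₗ (LieAlgebra.ad F L x₀ : L →ₗ[F] L))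
  have hχ : ∀ z, χ z = (φ x₀)⁻¹ * φ ⁅z, x₀⁆ := by
    intro z
    rw [← lie_skew, map_neg, mul_neg]
    rfl
  have h₀ : ∀ z : L, ⁅z, x₀⁆ = χ z • x₀ := by
    intro z
    obtain ⟨c, hc⟩ := hline x₀ hx₀A hx₀p z
    rw [hχ, ← hc, map_smul, smul_eq_mul, mul_comm, mul_inv_cancel_right₀ hφ]
  refine ⟨χ, fun a ha hap z => ?_⟩
  obtain ⟨c, hc⟩ := hline a ha hap z
  -- As a + x₀ is also an eigenvector, either all three eigenvalues agree or a is a multiple of x₀.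
  obtain ⟨d, hd⟩ := hline (a + x₀) (A.add_mem' ha hx₀A) (by
    rw [pMap_add_of_lie_eq_zero F p (hab _ hx₀A _ ha), hap, hx₀p, add_zero]) z
  rw [lie_add, h₀, ← hc, smul_add] at hd
  have hcd : (d - c) • a = (χ z - d) • x₀ := by
    rw [sub_smul, sub_smul, sub_eq_sub_iff_add_eq_add, hd, add_comm]
  by_cases hdc : d - c = 0
  · rw [hdc, zero_smul, eq_comm, smul_eq_zero, or_iff_left hx₀, sub_eq_zero] at hcd
    rw [← hc, hcd, sub_eq_zero.1 hdc]
  · have h1 : a = ((d - c)⁻¹ * (χ z - d)) • x₀ := by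
      rw [mul_smul, ← hcd, inv_smul_smul₀ hdc]
    rw [h1, lie_smul, h₀, smul_comm]

/-- If `L` acts on a nonzero element of a self-centralizing abelian restricted ideal by a nonzero
character whose kernel is the ideal, then the ideal is complemented by a toral element. -/
theorem IsDuallyAtomistic.exists_isToral [FiniteDimensional F L] (hL : IsDuallyAtomistic F p L)
    {A : RestrictedSubalgebra F p L} (hA : A.IsIdeal) (hab : ∀ x ∈ A, ∀ y ∈ A, ⁅x, y⁆ = 0)
    {χ : L →ₗ[F] F} (hker : ∀ x, χ x = 0 ↔ x ∈ A) (hχ : χ ≠ 0) {x₀ : L} (hx₀ : x₀ ≠ 0)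
    (hact : ∀ z : L, ⁅z, x₀⁆ = χ z • x₀) :
    ∃ b : L, b ≠ 0 ∧ IsToral F p b ∧ IsCompl A.toSubmodule (Submodule.span F {b}) := by
  obtain ⟨B, -, hsup, hdisj⟩ := hL.exists_complement hA hab le_rfl ⊤
  obtain ⟨y, hy⟩ : ∃ y, χ y ≠ 0 := by
    by_contra! h
    exact hχ (LinearMap.ext h)
  obtain ⟨a, ha, b₁, hb₁, rfl⟩ := Submodule.mem_sup.1 (hsup (Submodule.mem_top (x := y)))
  rw [map_add, (hker a).2 ha, zero_add] at hy
  set b := (χ b₁)⁻¹ • b₁ with hbdef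
  have hbB : b ∈ B := B.smul_mem' _ hb₁
  have hb : χ b = 1 := by
    rw [hbdef, map_smul, smul_eq_mul, inv_mul_cancel₀ hy]
  -- The difference lies in ker χ = A and in B, which meet in 0.
  have hB : ∀ z ∈ B, z = χ z • b := by
    intro z hz
    refine sub_eq_zero.1 (Submodule.disjoint_def.1 hdisj _ ((hker _).1 ?_)
      (B.toSubmodule.sub_mem hz (B.smul_mem' _ hbB)))
    rw [map_sub, map_smul, hb, smul_eq_mul, mul_one, sub_self]
  have hspan : B.toSubmodule = Submodule.span F {b} := by
    refine le_antisymm (fun z hz => ?_) ((Submodule.span_singleton_le_iff_mem b _).2 hbB)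
    exact Submodule.mem_span_singleton.2 ⟨χ z, (hB z hz).symm⟩
  refine ⟨b, fun h => one_ne_zero (α := F) (by rw [← hb, h, map_zero]), ?_, ?_⟩
  · have hpow : ∀ k : ℕ, (LieAlgebra.ad F L b ^ k) x₀ = x₀ := by
      intro k
      induction k with
      | zero => rfl
      | succ k ih =>
        rw [pow_succ', Module.End.mul_apply, ih, LieAlgebra.ad_apply, hact, hb, one_smul]
    -- b^[p] acts on x₀ as (ad b)^p, that is, by 1; as b^[p] lies in the line B, it equals b.
    have h1 : χ (pMap F p b) = 1 := by
      have := hact (pMap F p b)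
      rw [lie_pMap, hpow, eq_comm] at this
      have h2 : (χ (pMap F p b) - 1) • x₀ = 0 := by rw [sub_smul, this, one_smul, sub_self]
      exact sub_eq_zero.1 ((smul_eq_zero.1 h2).resolve_right hx₀)
    have := hB _ (B.pMap_mem' hbB)
    rwa [h1, one_smul] at this
  · rw [← hspan]
    exact ⟨hdisj, codisjoint_iff_le_sup.2 hsup⟩

end

/-! ### Assembly of the decomposition. -/

theorem mainTheorem5 {F : Type*} [Field F] {p : ℕ} [Fact p.Prime] [CharP F p]
    {L : Type*} [LieRing L] [LieAlgebra F L] [FiniteDimensional F L]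
    [RestrictedLieAlgebra F p L] [LieAlgebra.IsSolvable L] (hL : IsDuallyAtomistic F p L) :
    ∃ (A : RestrictedSubalgebra F p L) (b : L) (n r : ℕ)
      (P : Fin n → RestrictedSubalgebra F p L),
      A.IsIdeal ∧ IsLieAbelian A ∧
      IsToral F p b ∧
      IsCompl A.toSubmodule (Submodule.span F {b}) ∧
      iSupIndep (fun i => (P i).toSubmodule) ∧ (⨆ i, (P i).toSubmodule) = A.toSubmodule ∧
      r ≤ n ∧
      (∀ i : Fin n, (i : ℕ) < r → ∃ f : SkewPolynomial F, IsIrreducibleSkew F p f ∧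
        Nonempty (RestrictedLieEquiv F p (P i) (CyclicQuotient F p f))) ∧
      (∀ i : Fin n, r ≤ (i : ℕ) → ∃ x : L, x ≠ 0 ∧ (P i).toSubmodule = Submodule.span F {x}) ∧
      (¬ IsLieAbelian L → r ≠ n ∧ b ≠ 0) ∧
      (IsLieAbelian L → r = n ∧ b = 0) := by
  obtain ⟨A, hA, hab, hcent⟩ := hL.exists_self_centralizing
  have hAab : IsLieAbelian A := ⟨fun x y => Subtype.ext (hab x x.2 y y.2)⟩
  obtain ⟨ι, _, P, hP, hind, hsum⟩ := hL.exists_iSupIndep_isMinimal hA hab A le_rfl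
  have hPA : ∀ i, P i ≤ A := fun i x hx => by
    have : x ∈ ⨆ i, (P i).toSubmodule := Submodule.mem_iSup_of_mem i hx
    rwa [hsum] at this
  have hcyc : ∀ i, ∃ f : SkewPolynomial F, IsIrreducibleSkew F p f ∧
      Nonempty (RestrictedLieEquiv F p (P i) (CyclicQuotient F p f)) := fun i =>
    (hP i).exists_equiv_cyclicQuotient fun x hx y hy => hab x (hPA i hx) y (hPA i hy)
  by_cases hLab : IsLieAbelian L
  -- Only the numbering matters here: every summand is cyclic, so n itself is used in place of r.
  · obtain ⟨n, r, e, hr, -⟩ := exists_equiv_fin_lt_iff fun _ : ι => True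
    refine ⟨A, 0, n, n, P ∘ e, hA, hAab, pMap_zero F p, ?_, hind.comp e.injective,
      (e.iSup_comp (g := fun i => (P i).toSubmodule)).trans hsum, le_rfl, fun i _ => hcyc (e i),
      fun i hi => absurd i.2 (by omega), fun h => absurd hLab h, fun _ => ⟨rfl, rfl⟩⟩
    have : A.toSubmodule = ⊤ :=
      eq_top_iff.2 fun x _ => hcent x fun a _ => trivial_lie_zero L L x a
    rw [this, Submodule.span_zero_singleton]
    exact isCompl_top_bot
  · obtain ⟨n, r, e, hr, he⟩ := exists_equiv_fin_lt_iff fun i => ∃ a ∈ P i, pMap F p a ≠ 0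
    have hline : ∀ i, (¬ ∃ a ∈ P i, pMap F p a ≠ 0) → ∀ a ∈ P i, pMap F p a = 0 := by
      intro i h
      push Not at h
      exact h
    have hcentral : ∀ i, (∃ a ∈ P i, pMap F p a ≠ 0) → P i ≤ RestrictedSubalgebra.center F p L :=
      fun i h => (hP i).le_center hA hab (hPA i) h
    have hAle : ∀ z : L, (∀ i, ∀ a ∈ P i, ⁅z, a⁆ = 0) → z ∈ A := by
      intro z hz
      refine hcent z fun a ha => ?_
      have hle : ⨆ i, (P i).toSubmodule ≤ LinearMap.ker (LieAlgebra.ad F L z : L →ₗ[F] L) :=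
        iSup_le fun i a ha => hz i a ha
      rw [hsum] at hle
      exact hle ha
    have hzc : ∀ z : L, ∀ a ∈ RestrictedSubalgebra.center F p L, ⁅z, a⁆ = 0 := fun z a ha => by
      rw [← lie_skew, show ⁅a, z⁆ = 0 from ha z, neg_zero]
    -- If the p-map were nonzero on every summand, A would be central, so L would equal its
    -- centralizer A and be abelian.
    obtain ⟨i₀, hi₀⟩ : ∃ i, ¬ ∃ a ∈ P i, pMap F p a ≠ 0 := by
      by_contra! h
      have hall : ∀ z : L, z ∈ A := fun z =>
        hAle z fun i a ha => hzc z a (hcentral i (h i) ha)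
      exact hLab ⟨fun x y => hab x (hall x) y (hall y)⟩
    obtain ⟨x₀, hx₀, hx₀P, -⟩ := (hP i₀).exists_eq_span (hline i₀ hi₀)
    obtain ⟨χ, hχ⟩ := hL.exists_character hA hab hx₀ (hPA i₀ hx₀P) (hline i₀ hi₀ x₀ hx₀P)
    have hact := hχ x₀ (hPA i₀ hx₀P) (hline i₀ hi₀ x₀ hx₀P)
    -- An element of ker χ commutes with the central summands and with the lines, hence centralizes
    -- A.
    have hker : ∀ x, χ x = 0 ↔ x ∈ A := by
      refine fun x => ⟨fun hx => hAle x fun i a ha => ?_, fun hx => ?_⟩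
      · by_cases hi : ∃ a ∈ P i, pMap F p a ≠ 0
        · exact hzc x a (hcentral i hi ha)
        · rw [hχ a (hPA i ha) (hline i hi a ha), hx, zero_smul]
      · have := hact x
        rw [hab x hx x₀ (hPA i₀ hx₀P)] at this
        exact (smul_eq_zero.1 this.symm).resolve_right hx₀
    have hχ0 : χ ≠ 0 := by
      rintro rfl
      have hall : ∀ z : L, z ∈ A := fun z => (hker z).1 rfl
      exact hLab ⟨fun x y => hab x (hall x) y (hall y)⟩
    obtain ⟨b, hb, hbt, hcompl⟩ := hL.exists_isToral hA hab hker hχ0 hx₀ hact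
    refine ⟨A, b, n, r, P ∘ e, hA, hAab, hbt, hcompl, hind.comp e.injective,
      (e.iSup_comp (g := fun i => (P i).toSubmodule)).trans hsum, hr, fun i _ => hcyc (e i),
      fun i hi => ?_, fun _ => ⟨?_, hb⟩, fun h => absurd h hLab⟩
    · obtain ⟨x, hx, -, hspan⟩ := (hP (e i)).exists_eq_span
        (hline _ fun h => absurd ((he i).2 h) (by omega))
      exact ⟨x, hx, hspan⟩
    · rintro rfl
      refine hi₀ ?_
      have := (he (e.symm i₀)).1 (e.symm i₀).2
      rwa [e.apply_symm_apply] at this
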